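/- **Setting.** Let $\mathcal A$ be a finite action set, $\mathcal Y$ the outcome space (a standard Borel space, e.g. a Borel subset of a Euclidean space) and $R:\mathcal Y\to\mathbb R$ a measurable reward function. On a probability space there is a random outcome distribution $p^*$ on $\mathcal Y^{\mathcal A}$, taking values in a family $\mathcal P$; conditionally on $p^*$ the outcome vectors $Y_t=(Y_{t,a})_{a\in\mathcal A}$ are i.i.d. with law $p^*$. The optimal action $A^*\in\arg\max_{a}\mathbb E[R(Y_{t,a})\mid p^*]$ is a function of $p^*$. Let $\mathcal F_t$ be the $\sigma$-algebra generated by the history $(A_s,Y_{s,A_s})_{s<t}$; the action $A_t$ is a measurable function of the history and of a random seed $U_t$, where each $U_t$ is independent of $((U_s)_{s\ne t},(Y_{s,a})_{s,a},p^*)$. Write $\mathbb P_t=\mathbb P(\cdot\mid\mathcal F_t)$, $\mathbb E_t=\mathbb E[\cdot\mid\mathcal F_t]$, $P_t(X)=\mathbb P_t(X\in\cdot)$, $D$ for Kullback–Leibler divergence, and $I_t(X;Y)=D(P_t(X,Y)\,\|\,P_t(X)P_t(Y))$ for mutual information under $\mathbb P_t$. A real random variable $X$ is $\sigma$ sub-Gaussian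 conditionally on $\mathcal F_t$ if for every $\lambda\in\mathbb R$, $\mathbb E[e^{\lambda X}\mid\mathcal F_t]\le e^{\lambda^2\sigma^2/2}$ almost surely. Thompson sampling is the policy with $\mathbb P_t(A_t=a)=\mathbb P_t(A^*=a)$ for all $t$ and $a$. Put $$\Gamma_t=\frac{\big(\mathbb E_t[R(Y_{t,A^*})-R(Y_{t,A_t})]\big)^2}{I_t\big(A^*;(A_t,Y_{t,A_t})\big)}$$ with $0/0=0$ and $x/0=\infty$ for $x>0$. Fix a period $t$. **(1)** Let $\sigma\ge 0$ be an $\mathcal F_t$-measurable random variable such that for every $a\in\mathcal A$, $R(Y_{t,a})-\mathbb E_t[R(Y_{t,a})]$ is $\sigma$ sub-Gaussian conditionally on $\mathcal F_t$. Then for all $a,a^*\in\mathcal A$, almost surely on the event $\mathbb P_t(A^*=a^*)>0$, the expectations and the divergence below are finite and $$\mathbb E_t[R(Y_{t,a})\mid A^*=a^*]-\mathbb E_t[R(Y_{t,a})]\le\sigma\sqrt{2\,D\big(P_t(Y_{t,a}\mid A^*=a^*)\,\|\,P_t(Y_{t,a})\big)} .$$ **(2)** Let actions be chosen by Thompson sampling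 and let $\sigma\in\mathbb R$ be a constant such that for every $a$, $R(Y_{t,a})-\mathbb E_t[R(Y_{t,a})]$ is $\sigma$ sub-Gaussian conditionally on $\mathcal F_t$. Then, almost surely, the expectation and the mutual information in $\Gamma_t$ are finite and: * $\Gamma_t\le 2|\mathcal A|\sigma^2$; * (full information) if there is a random variable $Z_t$ with $Y_{t,a}=(a,Z_t)$ for every $a$, then $\Gamma_t\le 2\sigma^2$; * (linear bandit) if each action $a$ has a feature vector in $\mathbb R^d$, also written $a$, and for every $p\in\mathcal P$ there is $\theta_p\in\mathbb R^d$ with $\mathbb E_{y\sim p_a}[R(y)]=a^{T}\theta_p$ for all $a$, where $p_a$ is the $a$-th marginal of $p$, then $\Gamma_t\le 2d\sigma^2$. **(3)** (Semi-bandit.) Let actions be chosen by Thompson sampling, let $m\ge1$, let the actions be subsets of $\{1,\dots,d\}$ of size at most $m$, and let $\theta_{t,1},\dots,\theta_{t,d}$ be real random variables, independent conditionally on $\mathcal F_t$, with $Y_{t,a}=(\theta_{t,i}:i\in a)$ and $R(Y_{t,a})=\frac1m\sum_{i\in a}\theta_{t,i}$. If $\sigma\in\mathbb R$ is a constant such that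 $\theta_{t,i}-\mathbb E_t[\theta_{t,i}]$ is $\sigma$ sub-Gaussian conditionally on $\mathcal F_t$ for every $i$, then almost surely the expectation and the mutual information in $\Gamma_t$ are finite and $\Gamma_t\le 2d\sigma^2/m^2$. -/

import Mathlib

open MeasureTheory ProbabilityTheory InformationTheory Set
open scoped ENNReal

noncomputable section

/-- The history before period `t`: the pairs `(A_s, Y_{s, A_s})` for `s < t`
(periods are numbered from `0`). -/
def banditHistory {Ω A 𝒴 : Type*} (act : ℕ → Ω → A) (Y : ℕ → A → Ω → 𝒴) (t : ℕ) (ω : Ω) :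
    Fin t → A × 𝒴 :=
  fun s => (act s ω, Y s (act s ω) ω)

/-- A Bayesian bandit problem together with a randomized policy, on a probability space `(Ω, μ)`,
with action set `A`, outcome space `𝒴` and space `𝒰` of external random seeds. -/
structure BanditModel {Ω : Type*} [MeasurableSpace Ω] (μ : Measure Ω)
    (A 𝒴 𝒰 : Type*) [MeasurableSpace A] [MeasurableSpace 𝒴] [MeasurableSpace 𝒰] where
  /-- the family of outcome distributions -/
  family : Set (Measure (A → 𝒴))
  family_prob : ∀ p ∈ family, IsProbabilityMeasure p
  /-- the (random) true outcome distribution `p*` -/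
  pstar : Ω → Measure (A → 𝒴)
  measurable_pstar : Measurable pstar
  pstar_mem : ∀ ω, pstar ω ∈ family
  /-- the outcome `Y_{t,a}` of action `a` in period `t` -/
  Y : ℕ → A → Ω → 𝒴
  measurable_Y : ∀ t a, Measurable (Y t a)
  /-- conditionally on `p*`, the vectors `Y_t = (Y_{t,a})_a` are i.i.d. with law `p*` -/
  cond_iid : ∀ (s : Finset ℕ) (B : ℕ → Set (A → 𝒴)) (C : Set (Measure (A → 𝒴))),
    (∀ t, MeasurableSet (B t)) → MeasurableSet C →
      μ (pstar ⁻¹' C ∩ ⋂ t ∈ s, {ω | (fun a => Y t a ω) ∈ B t}) =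
        ∫⁻ ω in pstar ⁻¹' C, ∏ t ∈ s, pstar ω (B t) ∂μ
  /-- the reward function -/
  R : 𝒴 → ℝ
  measurable_R : Measurable R
  /-- the optimal action, a function of `p*` that maximizes the mean reward under `p*` -/
  Astar : Ω → A
  measurable_Astar : Measurable[MeasurableSpace.comap pstar inferInstance] Astar
  optimal : ∀ᵐ ω ∂μ, ∀ a, ∫ y, R (y a) ∂(pstar ω) ≤ ∫ y, R (y (Astar ω)) ∂(pstar ω)
  /-- the external randomness -/
  U : ℕ → Ω → 𝒰
  measurable_U : ∀ t, Measurable (U t)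
  indep_U : ∀ t, IndepFun (U t)
    (fun ω => ((fun s : {s : ℕ // s ≠ t} => U s ω), (fun (s : ℕ) (a : A) => Y s a ω), pstar ω)) μ
  /-- the action taken in period `t`; it is a function of the history and of `U t` -/
  act : ℕ → Ω → A
  measurable_act : ∀ t, Measurable[MeasurableSpace.comap (banditHistory act Y t) inferInstance ⊔
    MeasurableSpace.comap (U t) inferInstance] (act t)

/-- The mutual information `I(X; Y)` under the base measure `P`: the Kullback--Leibler divergence
between the joint law and the product of the marginal laws. -/
def mutualInfo {S E F : Type*} [MeasurableSpace S] [MeasurableSpace E] [MeasurableSpace F]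
    (P : Measure S) (X : S → E) (Y : S → F) : ℝ≥0∞ :=
  klDiv (P.map (fun w => (X w, Y w))) ((P.map X).prod (P.map Y))

namespace BanditModel

variable {Ω : Type*} [MeasurableSpace Ω] {μ : Measure Ω} [IsFiniteMeasure μ]
  {A 𝒴 𝒰 : Type*} [Fintype A] [Nonempty A] [MeasurableSpace A] [DiscreteMeasurableSpace A]
  [MeasurableSpace 𝒴] [StandardBorelSpace 𝒴] [Nonempty 𝒴] [MeasurableSpace 𝒰]

/-- The history `(A_s, Y_{s, A_s})_{s < t}`. -/
def hist (M : BanditModel μ A 𝒴 𝒰) (t : ℕ) : Ω → Fin t → A × 𝒴 := banditHistory M.act M.Y t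

/-- The sigma-algebra `F_t` generated by the history. -/
abbrev histSigma (M : BanditModel μ A 𝒴 𝒰) (t : ℕ) : MeasurableSpace Ω :=
  MeasurableSpace.comap (M.hist t) inferInstance

/-- `P_t(X)`: the (regular) conditional law of the random variable `X` given `F_t`. -/
def condLaw (M : BanditModel μ A 𝒴 𝒰) (t : ℕ) {E : Type*} [MeasurableSpace E]
    [StandardBorelSpace E] [Nonempty E] (X : Ω → E) (ω : Ω) : Measure E :=
  condDistrib X (M.hist t) μ (M.hist t ω)

/-- The posterior measure `P_t` at `ω`, as the joint conditional law of `(A*, A_t, (Y_{t,a})_a)`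
given `F_t`. Under it a point is written `w = (a*, a, y)`, so that `A*` is `w.1`, `A_t` is `w.2.1`
and `Y_{t,a}` is `w.2.2 a`. -/
def posterior (M : BanditModel μ A 𝒴 𝒰) (t : ℕ) (ω : Ω) : Measure (A × A × (A → 𝒴)) :=
  M.condLaw t (fun ω' => (M.Astar ω', M.act t ω', fun a => M.Y t a ω')) ω

/-- The reward `R(Y_{t,a})`. -/
def reward (M : BanditModel μ A 𝒴 𝒰) (t : ℕ) (a : A) (ω : Ω) : ℝ := M.R (M.Y t a ω)

/-- `X - E[X | F_t]` is `σ` sub-Gaussian conditionally on `F_t`: for every real `l`,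
`E[exp (l (X - E[X | F_t])) | F_t] ≤ exp (l ^ 2 σ ^ 2 / 2)` almost surely (in particular the left
side is finite). The conditional expectations are integrals against the conditional law of `X`. -/
def CenteredSubGaussian (M : BanditModel μ A 𝒴 𝒰) (t : ℕ) (X : Ω → ℝ) (σ : Ω → ℝ) : Prop :=
  ∀ l : ℝ, ∀ᵐ ω ∂μ,
    Integrable (fun x => Real.exp (l * (x - ∫ z, z ∂(M.condLaw t X ω)))) (M.condLaw t X ω) ∧
    ∫ x, Real.exp (l * (x - ∫ z, z ∂(M.condLaw t X ω))) ∂(M.condLaw t X ω) ≤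
      Real.exp (l ^ 2 * σ ω ^ 2 / 2)

/-- The posterior measure `P_t( · | A* = a*)` at `ω`. -/
def posteriorGiven (M : BanditModel μ A 𝒴 𝒰) (t : ℕ) (astar : A) (ω : Ω) :
    Measure (A × A × (A → 𝒴)) :=
  ProbabilityTheory.cond (M.posterior t ω) {w | w.1 = astar}

/-- `D(P_t(Y_{t,a} | A* = a*) || P_t(Y_{t,a}))`. -/
def outcomeDiv (M : BanditModel μ A 𝒴 𝒰) (t : ℕ) (a astar : A) (ω : Ω) : ℝ≥0∞ :=
  klDiv ((M.posteriorGiven t astar ω).map (fun w => w.2.2 a))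
    ((M.posterior t ω).map (fun w => w.2.2 a))

/-- `R(Y_{t,A*}) - R(Y_{t,A_t})` as a random variable under the posterior measure. -/
def regretVar (M : BanditModel μ A 𝒴 𝒰) (w : A × A × (A → 𝒴)) : ℝ :=
  M.R (w.2.2 w.1) - M.R (w.2.2 w.2.1)

/-- The information gain `I_t(A*; (A_t, Y_{t,A_t}))`. -/
def infoGain (M : BanditModel μ A 𝒴 𝒰) (t : ℕ) (ω : Ω) : ℝ≥0∞ :=
  mutualInfo (M.posterior t ω) (fun w => w.1) (fun w => (w.2.1, w.2.2 w.2.1))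

/-- The information ratio `Γ_t`, with values in `[0, ∞]`; here `0 / 0 = 0` and `x / 0 = ∞` for
`x > 0`. -/
def infoRatio (M : BanditModel μ A 𝒴 𝒰) (t : ℕ) (ω : Ω) : ℝ≥0∞ :=
  ENNReal.ofReal ((∫ w, M.regretVar w ∂(M.posterior t ω)) ^ 2) / M.infoGain t ω

/-- The quantities in `Γ_t` are well defined and finite at `ω`, and `Γ_t ≤ c`. -/
def InfoRatioLE (M : BanditModel μ A 𝒴 𝒰) (t : ℕ) (c : ℝ) (ω : Ω) : Prop :=
  Integrable M.regretVar (M.posterior t ω) ∧ M.infoGain t ω ≠ ∞ ∧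
    M.infoRatio t ω ≤ ENNReal.ofReal c

/-- Thompson sampling: `P(A_t = a | F_t) = P(A* = a | F_t)`. -/
def IsThompsonSampling (M : BanditModel μ A 𝒴 𝒰) : Prop :=
  ∀ t a, ∀ᵐ ω ∂μ, M.posterior t ω {w | w.2.1 = a} = M.posterior t ω {w | w.1 = a}

/-- Full information in period `t`: the outcome `Y_{t,a}` is the pair `(a, Z)`. The outcome space
need not literally be `A × 𝒵`: the map `enc a` says how `(a, z)` is encoded as an outcome. -/
structure IsFullInformation (M : BanditModel μ A 𝒴 𝒰) (t : ℕ) {𝒵 : Type*} [MeasurableSpace 𝒵]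
    (Z : Ω → 𝒵) (enc : A → 𝒵 → 𝒴) : Prop where
  measurable_Z : Measurable Z
  enc_embedding : ∀ a, MeasurableEmbedding (enc a)
  outcome_eq : ∀ a ω, M.Y t a ω = enc a (Z ω)

/-- Linear bandit: action `a` has feature vector `φ a`, and under every `p` in the family the mean
rewards are linear in the features. -/
def IsLinear (M : BanditModel μ A 𝒴 𝒰) {d : ℕ} (φ : A → Fin d → ℝ) : Prop :=
  ∀ p ∈ M.family, ∃ θ : Fin d → ℝ, ∀ a, ∫ y, M.R (y a) ∂p = ∑ i, φ a i * θ i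

/-- Semi-bandit feedback in period `t`: action `a` is a subset `S a` of at most `m` of the `d`
items, its outcome is the vector `(θ_i : i ∈ S a)`, its reward is `m⁻¹ ∑_{i ∈ S a} θ_i`, and the
`θ_i` are independent conditionally on `F_t`. The map `enc a` says how a vector indexed by `S a` is
encoded as an outcome. -/
structure IsSemiBandit (M : BanditModel μ A 𝒴 𝒰) (t : ℕ) {d : ℕ} (m : ℕ)
    (S : A → Finset (Fin d)) (θ : Fin d → Ω → ℝ) (enc : (a : A) → (S a → ℝ) → 𝒴) : Prop where
  card_le : ∀ a, (S a).card ≤ m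
  measurable_θ : ∀ i, Measurable (θ i)
  enc_measurable : ∀ a, Measurable (enc a)
  enc_injective : ∀ a, Function.Injective (enc a)
  outcome_eq : ∀ a ω, M.Y t a ω = enc a (fun i => θ i ω)
  reward_eq : ∀ a x, M.R (enc a x) = (1 / (m : ℝ)) * ∑ i, x i
  cond_indep : ∀ᵐ ω ∂μ,
    iIndepFun (fun (i : Fin d) (x : Fin d → ℝ) => x i) (M.condLaw t (fun ω' i => θ i ω') ω)

end BanditModel

end

/-! Everything happens under the posterior at a fixed history: a probability measure `P` on triples
(optimal action, chosen action, outcome vector). The seed is fresh, so under `P` the chosen action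
is independent of the other two coordinates, and Thompson sampling gives it the law `p` of the
optimal action.

The analytic input is the Donsker–Varadhan inequality: `∫ f dQ ≤ D(Q‖P)` whenever `∫ exp f dP ≤ 1`.
With `f = l (X - E X) - l² c / 2` and `X` sub-Gaussian, it bounds the change of a mean by the
divergence, which is claim (1). Applied to the joint law of the optimal action and the observation
against the product of the marginals, it gives `sum_integral_le_mutualInfo`; no chain rule for
information is needed. Slopes proportional to the gaps `g b a = E[R(Y_a) | A* = b] - E[R(Y_a)]` then
give `∑ p_a p_b (g b a)² ≤ 2 c I` (`sum_sq_gap_le_mutualInfo`).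

The expected regret is `∑ p_a g a a`, the trace of the matrix `√(p_a p_b) g b a`, whose squared
Frobenius norm is the sum just bounded. Squared trace is at most rank times squared Frobenius norm;
the rank is at most `|A|`, or `d` for linear rewards. Under full information every observation
reveals the reward of every action, so `g b a` may be replaced by `g b b`, and Jensen's inequality
removes the dimension. For semi-bandits the test function is a sum over items; independence factors
its exponential moment, and Cauchy–Schwarz over the `d` items finishes.

The rest is measure theory: deriving the posterior independence from the model, and showing that for
linear bandits the vectors of gaps lie almost surely in the span of the features. -/

/-! ### Divergence and sub-Gaussian variables -/

section Divergence

variable {α : Type*} [MeasurableSpace α]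

/-- A measure dominated by a multiple of another one has finite divergence from it. -/
lemma klDiv_ne_top_of_le_smul {Q P : Measure α} [IsFiniteMeasure Q] [IsFiniteMeasure P]
    {c : ℝ≥0∞} (hc : c ≠ ∞) (h : Q ≤ c • P) : klDiv Q P ≠ ∞ := by
  have hac : Q ≪ P := Measure.absolutelyContinuous_of_le_smul h
  have hle : Q.rnDeriv P ≤ᵐ[P] fun _ => c := by
    refine ae_le_of_forall_setLIntegral_le_of_sigmaFinite (Measure.measurable_rnDeriv Q P) ?_
    intro s _ _
    rw [setLIntegral_const]
    exact (Measure.setLIntegral_rnDeriv_le s).trans (by simpa using h s)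
  rw [klDiv_eq_lintegral_klFun_of_ac hac]
  -- From `log r ≤ r - 1`, `klFun r ≤ (r - 1)² ≤ r² + 1 ≤ c² + 1` for a density value `0 ≤ r ≤ c`.
  refine ne_top_of_le_ne_top (b := ∫⁻ _, ENNReal.ofReal (c.toReal ^ 2 + 1) ∂P) ?_ ?_
  · rw [lintegral_const]
    exact ENNReal.mul_ne_top ENNReal.ofReal_ne_top (measure_ne_top _ _)
  · refine lintegral_mono_ae ?_
    filter_upwards [hle] with x hx
    refine ENNReal.ofReal_le_ofReal ?_
    have hx' : (Q.rnDeriv P x).toReal ≤ c.toReal := ENNReal.toReal_mono hc hx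
    have h0 : 0 ≤ (Q.rnDeriv P x).toReal := ENNReal.toReal_nonneg
    generalize (Q.rnDeriv P x).toReal = r at hx' h0
    rw [klFun_apply]
    rcases h0.eq_or_lt with rfl | hr
    · simp
    · nlinarith [mul_le_mul_of_nonneg_left (Real.log_le_sub_one_of_pos hr) h0]

/-- One half of the Donsker--Varadhan variational formula. -/
lemma integral_le_toReal_klDiv {Q P : Measure α} [IsProbabilityMeasure Q]
    [IsProbabilityMeasure P] (hD : klDiv Q P ≠ ∞) {f : α → ℝ} (hf : Measurable f)
    (hfQ : Integrable f Q) (hexp : ∫⁻ x, ENNReal.ofReal (Real.exp (f x)) ∂P ≤ 1) :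
    ∫ x, f x ∂Q ≤ (klDiv Q P).toReal := by
  obtain ⟨hac, hint⟩ := klDiv_ne_top_iff.mp hD
  have hfP : Integrable (fun x => Real.exp (f x)) P := by
    refine ⟨hf.exp.aestronglyMeasurable, ?_⟩
    rw [hasFiniteIntegral_iff_ofReal (ae_of_all _ fun x => (Real.exp_pos _).le)]
    exact hexp.trans_lt ENNReal.one_lt_top
  have hle1 : ∫ x, Real.exp (f x) ∂P ≤ 1 := by
    rw [integral_eq_lintegral_of_nonneg_ae (ae_of_all _ fun x => (Real.exp_pos _).le) hfP.1]
    exact ENNReal.toReal_le_of_le_ofReal zero_le_one (by simpa using hexp)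
  have hlog : Real.log (∫ x, Real.exp (f x) ∂P) ≤ 0 :=
    Real.log_nonpos (integral_nonneg fun x => (Real.exp_pos _).le) hle1
  -- The divergence of `Q` from the tilted measure, proportional to `exp f · P`, is nonnegative. It
  -- equals `D(Q‖P) - ∫ f dQ + log ∫ exp f dP`, and the logarithm is at most zero.
  have hac' : Q ≪ P.tilted f := hac.trans (absolutelyContinuous_tilted hfP)
  have : IsProbabilityMeasure (P.tilted f) := isProbabilityMeasure_tilted hfP
  have h := integral_llr_add_sub_measure_univ_nonneg hac'
    (integrable_llr_tilted_right hac hfQ hint hfP)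
  rw [integral_llr_tilted_right hac hfQ hfP hint] at h
  simp only [probReal_univ] at h
  rw [toReal_klDiv_of_measure_eq hac (by simp)]
  linarith

open scoped NNReal in
/-- The sub-Gaussian bound on the moment generating function extends from rational arguments. -/
lemma hasSubgaussianMGF_of_rat {P : Measure α} {X : α → ℝ} {c : ℝ≥0}
    (h : ∀ q : ℚ, Integrable (fun x => Real.exp (q * X x)) P ∧
      ∫ x, Real.exp (q * X x) ∂P ≤ Real.exp (c * (q : ℝ) ^ 2 / 2)) :
    HasSubgaussianMGF X c P := by
  have hint : ∀ t : ℝ, Integrable (fun x => Real.exp (t * X x)) P := by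
    intro t
    obtain ⟨q, hq⟩ := exists_rat_gt t
    obtain ⟨r, hr⟩ := exists_rat_lt t
    exact integrable_exp_mul_of_le_of_le (h r).1 (h q).1 hr.le hq.le
  refine ⟨hint, fun t => ?_⟩
  have hcl : IsClosed {t : ℝ | mgf X P t ≤ Real.exp (c * t ^ 2 / 2)} :=
    isClosed_le (continuous_mgf hint) (by fun_prop)
  have hd : DenseRange ((↑) : ℚ → ℝ) := Rat.denseRange_cast
  exact hd.induction_on (p := fun t => mgf X P t ≤ Real.exp (c * t ^ 2 / 2)) t hcl
    fun q => (h q).2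

lemma ProbabilityTheory.HasSubgaussianMGF.lintegral_exp_le_one {P : Measure α} {X : α → ℝ} {c : NNReal}
    (h : HasSubgaussianMGF X c P) (l : ℝ) :
    ∫⁻ x, ENNReal.ofReal (Real.exp (l * X x - l ^ 2 * c / 2)) ∂P ≤ 1 := by
  have hi := h.integrable_exp_mul l
  have : ∀ x, Real.exp (l * X x - l ^ 2 * c / 2) =
      Real.exp (l * X x) * Real.exp (-(l ^ 2 * c / 2)) := fun x => by
    rw [← Real.exp_add]; ring_nf
  simp_rw [this]
  rw [← ofReal_integral_eq_lintegral_ofReal (hi.mul_const _)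
    (ae_of_all _ fun x => by positivity), integral_mul_const, ← ENNReal.ofReal_one]
  refine ENNReal.ofReal_le_ofReal ?_
  calc _ ≤ Real.exp (c * l ^ 2 / 2) * Real.exp (-(l ^ 2 * c / 2)) :=
        mul_le_mul_of_nonneg_right (h.mgf_le l) (Real.exp_pos _).le
    _ = 1 := by rw [← Real.exp_add]; ring_nf; simp

/-- The optimal choice is `k = 1 / c`. If `c = 0` the left side is linear in `k`, which forces `S =
0`. -/
lemma le_two_mul_of_forall_quadratic_le {c S D : ℝ} (hc : 0 ≤ c) (hS : 0 ≤ S) (hD : 0 ≤ D)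
    (h : ∀ k : ℝ, (k - k ^ 2 * c / 2) * S ≤ D) : S ≤ 2 * c * D := by
  rcases hS.eq_or_lt with rfl | hS
  · positivity
  rcases hc.eq_or_lt with rfl | hc
  · have := h ((D + 1) / S)
    rw [mul_zero, zero_div, sub_zero, div_mul_cancel₀ _ hS.ne'] at this
    linarith
  · have := h (1 / c)
    have e : (1 / c - (1 / c) ^ 2 * c / 2) * S = S / (2 * c) := by field_simp; ring
    rw [e, div_le_iff₀ (by positivity)] at this
    linarith

/-- The change of a mean is controlled by the divergence. -/
lemma sq_integral_sub_le_klDiv {Q P : Measure α} [IsProbabilityMeasure Q]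
    [IsProbabilityMeasure P] (hD : klDiv Q P ≠ ∞) {X : α → ℝ} (hX : Measurable X)
    (hXQ : Integrable X Q) {c : NNReal} (h : HasSubgaussianMGF (fun x => X x - ∫ z, X z ∂P) c P) :
    (∫ x, X x ∂Q - ∫ x, X x ∂P) ^ 2 ≤ 2 * c * (klDiv Q P).toReal := by
  set m := ∫ x, X x ∂P with hm
  refine le_two_mul_of_forall_quadratic_le c.2 (sq_nonneg _) ENNReal.toReal_nonneg fun k => ?_
  set g := ∫ x, X x ∂Q - m with hg
  have hi : Integrable (fun x => k * g * (X x - m)) Q :=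
    (hXQ.sub (integrable_const m)).const_mul _
  -- The slope is a multiple of the gap `g` itself, so the result is quadratic in `g` and neither
  -- its sign nor `g = 0` needs a separate case.
  have := integral_le_toReal_klDiv hD (f := fun x => k * g * (X x - m) - (k * g) ^ 2 * c / 2)
    (by fun_prop) (hi.sub (integrable_const _)) (h.lintegral_exp_le_one (k * g))
  rw [integral_sub hi (integrable_const _), integral_const_mul,
    integral_sub hXQ (integrable_const m)] at this
  simp only [integral_const, probReal_univ, smul_eq_mul, one_mul, ← hg] at this
  linarith

end Divergence

/-- The square of the trace of a matrix of rank at most `d` is at most `d` times the square of its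
Frobenius norm. -/
lemma sq_trace_le_of_span_finrank_le {ι : Type*} [Fintype ι] {d : ℕ}
    (V : Submodule ℝ (EuclideanSpace ℝ ι)) (hV : Module.finrank ℝ V ≤ d)
    (v : ι → EuclideanSpace ℝ ι) (hv : ∀ a, v a ∈ V) :
    (∑ a, v a a) ^ 2 ≤ d * ∑ a, ∑ b, v a b ^ 2 := by
  classical
  let u := stdOrthonormalBasis ℝ V
  have hcoord : ∀ a, v a a = ∑ j, u.repr ⟨v a, hv a⟩ j * (u j : EuclideanSpace ℝ ι) a := by
    intro a
    have h := congrArg (fun x : V => (x : EuclideanSpace ℝ ι) a) (u.sum_repr ⟨v a, hv a⟩)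
    simpa using h.symm
  have hnorm : ∀ a, ∑ j, u.repr ⟨v a, hv a⟩ j ^ 2 = ∑ b, v a b ^ 2 := by
    intro a
    have h : ‖u.repr ⟨v a, hv a⟩‖ = ‖v a‖ := u.repr.norm_map ⟨v a, hv a⟩
    have h2 : ‖u.repr ⟨v a, hv a⟩‖ ^ 2 = ‖v a‖ ^ 2 := by rw [h]
    rw [EuclideanSpace.norm_sq_eq, EuclideanSpace.norm_sq_eq] at h2
    simpa only [Real.norm_eq_abs, sq_abs] using h2
  have hu : ∀ j, ∑ a, (u j : EuclideanSpace ℝ ι) a ^ 2 = 1 := by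
    intro j
    have h : ‖(u j : EuclideanSpace ℝ ι)‖ = 1 := u.orthonormal.1 j
    have h2 : ‖(u j : EuclideanSpace ℝ ι)‖ ^ 2 = 1 := by rw [h, one_pow]
    rw [EuclideanSpace.norm_sq_eq] at h2
    simpa only [Real.norm_eq_abs, sq_abs] using h2
  -- Cauchy–Schwarz over pairs (row, basis vector): the coordinates of the rows have total square
  -- the Frobenius norm squared, and the orthonormal basis vectors have total square `dim V`.
  calc (∑ a, v a a) ^ 2
      = (∑ p : ι × Fin (Module.finrank ℝ V), u.repr ⟨v p.1, hv p.1⟩ p.2 *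
          (u p.2 : EuclideanSpace ℝ ι) p.1) ^ 2 := by
        rw [Fintype.sum_prod_type]; simp_rw [hcoord]
    _ ≤ (∑ p : ι × Fin (Module.finrank ℝ V), u.repr ⟨v p.1, hv p.1⟩ p.2 ^ 2) *
          ∑ p : ι × Fin (Module.finrank ℝ V), (u p.2 : EuclideanSpace ℝ ι) p.1 ^ 2 :=
        Finset.sum_mul_sq_le_sq_mul_sq _ _ _
    _ = (∑ a, ∑ b, v a b ^ 2) * Module.finrank ℝ V := by
        rw [Fintype.sum_prod_type, Fintype.sum_prod_type_right]
        simp [hnorm, hu]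
    _ ≤ (∑ a, ∑ b, v a b ^ 2) * d := by gcongr
    _ = _ := mul_comm _ _

/-! ### Finite-valued random variables -/

section FiniteValued

variable {W A : Type*} [MeasurableSpace W] [Fintype A] [MeasurableSpace A]
  [DiscreteMeasurableSpace A] {P : Measure W} {X : W → A}

lemma sum_restrict_fiber (hX : Measurable X) : ∑ a, P.restrict {w | X w = a} = P := by
  have hU : (⋃ a, {w | X w = a}) = univ := by ext; simp
  rw [← Measure.sum_fintype, ← Measure.restrict_iUnion, hU, Measure.restrict_univ]
  · intro a b hab
    refine Set.disjoint_left.mpr fun w (h1 : X w = a) (h2 : X w = b) => hab (h1.symm.trans h2)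
  · exact fun a => hX (measurableSet_singleton a)

lemma lintegral_eq_sum_fiber (hX : Measurable X) (f : A → W → ℝ≥0∞) :
    ∫⁻ w, f (X w) w ∂P = ∑ a, ∫⁻ w in {w | X w = a}, f a w ∂P := by
  conv_lhs => rw [← sum_restrict_fiber (P := P) hX]
  rw [lintegral_finsetSum_measure]
  refine Finset.sum_congr rfl fun a _ => ?_
  refine setLIntegral_congr_fun (hX (measurableSet_singleton a)) fun w hw => ?_
  rw [show X w = a from hw]

lemma integrable_fiber (hX : Measurable X) {f : A → W → ℝ} (hf : ∀ a, Integrable (f a) P) :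
    Integrable (fun w => f (X w) w) P := by
  rw [← sum_restrict_fiber (P := P) hX, integrable_finsetSum_measure]
  intro a _
  refine IntegrableOn.congr_fun (f := f a) (hf a).integrableOn (fun w hw => ?_)
    (hX (measurableSet_singleton a))
  rw [show X w = a from hw]

lemma integral_eq_sum_fiber (hX : Measurable X) {f : A → W → ℝ} (hf : ∀ a, Integrable (f a) P) :
    ∫ w, f (X w) w ∂P = ∑ a, ∫ w in {w | X w = a}, f a w ∂P := by
  have hi : ∀ a ∈ Finset.univ, Integrable (fun w => f (X w) w) (P.restrict {w | X w = a}) :=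
    fun a _ => (integrable_fiber hX hf).integrableOn
  conv_lhs => rw [← sum_restrict_fiber (P := P) hX]
  rw [integral_finsetSum_measure hi]
  refine Finset.sum_congr rfl fun a _ => ?_
  refine setIntegral_congr_fun (hX (measurableSet_singleton a)) fun w hw => ?_
  simp only [show X w = a from hw]

lemma sum_measureReal_fiber [IsProbabilityMeasure P] (hX : Measurable X) :
    ∑ a, P.real {w | X w = a} = 1 := by
  have h := integral_eq_sum_fiber (P := P) hX (f := fun _ _ => (1 : ℝ))
    fun _ => integrable_const _
  simpa using h.symm

/-- A finite-valued random variable has finite mutual information with any other one. -/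
lemma mutualInfo_ne_top [IsProbabilityMeasure P] {F : Type*} [MeasurableSpace F] (hX : Measurable X)
    {Z : W → F} (hZ : Measurable Z) : mutualInfo P X Z ≠ ∞ := by
  classical
  have hXZ : Measurable fun w => (X w, Z w) := hX.prodMk hZ
  have : IsProbabilityMeasure (P.map X) := Measure.isProbabilityMeasure_map hX.aemeasurable
  have : IsProbabilityMeasure (P.map Z) := Measure.isProbabilityMeasure_map hZ.aemeasurable
  have : IsProbabilityMeasure (P.map fun w => (X w, Z w)) :=
    Measure.isProbabilityMeasure_map hXZ.aemeasurable
  -- On the fiber `X = b` the joint law is at most `1 / P(X = b)` times the product law; the sum of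
  -- these factors serves all fibers. Null fibers get `0`, since the inverse there would be `∞`.
  let u : A → ℝ≥0∞ := fun b => if P {w | X w = b} = 0 then 0 else (P {w | X w = b})⁻¹
  have hu : ∀ b, u b ≠ ∞ := by
    intro b
    by_cases h : P {w | X w = b} = 0 <;> simp [u, h]
  refine klDiv_ne_top_of_le_smul (c := ∑ b, u b) (by simp [ENNReal.sum_eq_top, hu]) ?_
  refine Measure.le_iff.mpr fun s hs => ?_
  rw [Measure.smul_apply, smul_eq_mul, Measure.prod_apply hs, Measure.map_apply hXZ hs,
    lintegral_map (measurable_measure_prodMk_left hs) hX,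
    lintegral_eq_sum_fiber hX (fun b _ => P.map Z (Prod.mk b ⁻¹' s))]
  have hcov : (fun w => (X w, Z w)) ⁻¹' s ⊆
      ⋃ b, ({w | X w = b} ∩ Z ⁻¹' (Prod.mk b ⁻¹' s)) := by
    intro w hw
    exact mem_iUnion.mpr ⟨X w, rfl, hw⟩
  calc P ((fun w => (X w, Z w)) ⁻¹' s)
      ≤ ∑ b, P ({w | X w = b} ∩ Z ⁻¹' (Prod.mk b ⁻¹' s)) :=
        (measure_mono hcov).trans (measure_iUnion_fintype_le _ _)
    _ ≤ ∑ b, u b * ∫⁻ _ in {w | X w = b}, P.map Z (Prod.mk b ⁻¹' s) ∂P := by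
        refine Finset.sum_le_sum fun b _ => ?_
        rw [setLIntegral_const, Measure.map_apply hZ (measurable_prodMk_left hs)]
        by_cases h : P {w | X w = b} = 0
        · rw [measure_inter_null_of_null_left _ h]; exact zero_le
        · simp only [u, h, if_false]
          rw [mul_comm (P _) (P _), ← mul_assoc, ENNReal.inv_mul_cancel h (measure_ne_top _ _),
            one_mul]
          exact measure_mono inter_subset_right
    _ ≤ ∑ b, (∑ b', u b') * ∫⁻ _ in {w | X w = b}, P.map Z (Prod.mk b ⁻¹' s) ∂P := by
        gcongr with b _
        exact Finset.single_le_sum (f := u) (fun _ _ => zero_le) (Finset.mem_univ b)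
    _ = _ := by rw [Finset.mul_sum]

end FiniteValued

/-! ### Regret and information gain under a posterior -/

section PosteriorMeasure

variable {A 𝒴 : Type*} [Fintype A] [MeasurableSpace A] [DiscreteMeasurableSpace A]
  [MeasurableSpace 𝒴] {P : Measure (A × A × (A → 𝒴))}

lemma measurable_eval_discrete {W : Type*} [MeasurableSpace W] {X : W → A} {y : W → A → 𝒴}
    (hX : Measurable X) (hy : Measurable y) : Measurable fun w => y w (X w) := by
  have h : Measurable fun q : A × (A → 𝒴) => q.2 q.1 :=
    measurable_from_prod_countable_right fun a => measurable_pi_apply a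
  exact h.comp (hX.prodMk hy)

lemma map_restrict_of_indepFun {W E F : Type*} [MeasurableSpace W] [MeasurableSpace E]
    [MeasurableSpace F] {P : Measure W} {X : W → E} {Z : W → F}
    (hZ : Measurable Z) (h : IndepFun X Z P) {s : Set E} (hs : MeasurableSet s) :
    (P.restrict (X ⁻¹' s)).map Z = P (X ⁻¹' s) • P.map Z := by
  ext t ht
  rw [Measure.map_apply hZ ht, Measure.restrict_apply (hZ ht), Measure.smul_apply,
    Measure.map_apply hZ ht, inter_comm, h.measure_inter_preimage_eq_mul s t hs ht, smul_eq_mul]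

/-- The information gain dominates every exponentially normalized functional of the optimal
action, the action and its outcome. -/
lemma sum_integral_le_mutualInfo [IsProbabilityMeasure P]
    (hind : IndepFun (fun w : A × A × (A → 𝒴) => w.2.1) (fun w => (w.1, w.2.2)) P)
    {F : A → A → 𝒴 → ℝ} (hF : ∀ b a, Measurable (F b a))
    (hint : ∀ b a, Integrable (fun w : A × A × (A → 𝒴) => F b a (w.2.2 a)) P)
    (hexp : ∀ b a, ∫⁻ w, ENNReal.ofReal (Real.exp (F b a (w.2.2 a))) ∂P ≤ 1) :
    ∑ b, ∑ a, P.real {w | w.2.1 = a} * ∫ w in {w | w.1 = b}, F b a (w.2.2 a) ∂P ≤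
      (mutualInfo P (fun w => w.1) (fun w => (w.2.1, w.2.2 w.2.1))).toReal := by
  have hX : Measurable fun w : A × A × (A → 𝒴) => w.1 := measurable_fst
  have hA : Measurable fun w : A × A × (A → 𝒴) => w.2.1 := by fun_prop
  have hY : Measurable fun w : A × A × (A → 𝒴) => w.2.2 := by fun_prop
  have hXY : Measurable fun w : A × A × (A → 𝒴) => (w.1, w.2.2) := by fun_prop
  have hZ : Measurable fun w : A × A × (A → 𝒴) => (w.2.1, w.2.2 w.2.1) :=
    hA.prodMk (measurable_eval_discrete hA hY)
  have hXZ := hX.prodMk hZ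
  have hf : Measurable fun q : A × A × 𝒴 => F q.1 q.2.1 q.2.2 :=
    measurable_from_prod_countable_right fun b =>
      measurable_from_prod_countable_right fun a => hF b a
  have := Measure.isProbabilityMeasure_map (μ := P) hX.aemeasurable
  have := Measure.isProbabilityMeasure_map (μ := P) hZ.aemeasurable
  have := Measure.isProbabilityMeasure_map (μ := P) hXZ.aemeasurable
  have hrestr : ∀ a, (P.restrict {w | w.2.1 = a}).map (fun w => (w.1, w.2.2)) =
      P {w | w.2.1 = a} • P.map (fun w => (w.1, w.2.2)) := fun a =>
    map_restrict_of_indepFun hXY hind (measurableSet_singleton a)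
  have hint' : Integrable (fun w : A × A × (A → 𝒴) => F w.1 w.2.1 (w.2.2 w.2.1)) P :=
    integrable_fiber (f := fun b w => F b w.2.1 (w.2.2 w.2.1)) hX fun b =>
      integrable_fiber (f := fun a w => F b a (w.2.2 a)) hA fun a => hint b a
  -- The normalization is checked under the product law. For fixed `b`, splitting on the chosen
  -- action and using its independence of the outcomes leaves an average over `a` of exponential
  -- moments at most one.
  have key := integral_le_toReal_klDiv (mutualInfo_ne_top (P := P) hX hZ) hf
    ((integrable_map_measure hf.aestronglyMeasurable hXZ.aemeasurable).mpr hint') (by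
      rw [lintegral_prod _ (by fun_prop)]
      have hb : ∀ b : A, ∫⁻ q : A × 𝒴, ENNReal.ofReal (Real.exp (F b q.1 q.2))
          ∂(P.map fun w => (w.2.1, w.2.2 w.2.1)) ≤ 1 := by
        intro b
        have hfb : Measurable fun q : A × 𝒴 => F b q.1 q.2 := hf.comp measurable_prodMk_left
        rw [lintegral_map (by fun_prop) hZ, lintegral_eq_sum_fiber hA
          (fun a w => ENNReal.ofReal (Real.exp (F b a (w.2.2 a))))]
        calc _ ≤ ∑ a, P {w | w.2.1 = a} := by
              refine Finset.sum_le_sum fun a _ => ?_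
              have hm : Measurable fun q : A × (A → 𝒴) =>
                  ENNReal.ofReal (Real.exp (F b a (q.2 a))) := by
                have := hF b a; fun_prop
              rw [← lintegral_map (f := fun q : A × (A → 𝒴) =>
                ENNReal.ofReal (Real.exp (F b a (q.2 a)))) hm hXY, hrestr, lintegral_smul_measure,
                lintegral_map hm hXY]
              exact (mul_le_mul_right (hexp b a) _).trans_eq (mul_one _)
          _ = 1 := by
              have h := lintegral_eq_sum_fiber (P := P) hA (fun _ _ => 1)
              simpa using h.symm
      calc _ ≤ ∫⁻ _, 1 ∂(P.map fun w => w.1) := lintegral_mono hb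
        _ = 1 := by simp)
  refine le_of_eq_of_le ?_ key
  rw [integral_map hXZ.aemeasurable hf.aestronglyMeasurable]
  rw [integral_eq_sum_fiber (f := fun a w => F w.1 a (w.2.2 a)) hA fun a =>
    integrable_fiber (f := fun b w => F b a (w.2.2 a)) hX fun b => hint b a, Finset.sum_comm]
  refine Finset.sum_congr rfl fun a _ => ?_
  have hm : Measurable fun q : A × (A → 𝒴) => F q.1 a (q.2 a) :=
    measurable_from_prod_countable_right fun b => (hF b a).comp (measurable_pi_apply a)
  rw [← integral_map (f := fun q : A × (A → 𝒴) => F q.1 a (q.2 a)) hXY.aemeasurable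
    hm.aestronglyMeasurable, hrestr, integral_smul_measure,
    integral_map hXY.aemeasurable hm.aestronglyMeasurable,
    integral_eq_sum_fiber (f := fun b w => F b a (w.2.2 a)) hX fun b => hint b a,
    smul_eq_mul, Finset.mul_sum]
  rfl

variable {R : 𝒴 → ℝ}

lemma integrable_regret (hR : ∀ a, Integrable (fun w : A × A × (A → 𝒴) => R (w.2.2 a)) P) :
    Integrable (fun w : A × A × (A → 𝒴) => R (w.2.2 w.1) - R (w.2.2 w.2.1)) P :=
  (integrable_fiber (f := fun a (w : A × A × (A → 𝒴)) => R (w.2.2 a)) measurable_fst hR).sub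
    (integrable_fiber (f := fun a (w : A × A × (A → 𝒴)) => R (w.2.2 a)) (X := fun w => w.2.1)
      (by fun_prop) hR)

/-- The chosen action has the law of the optimal one and is independent of the outcomes, so its mean
reward is `∑ P(A* = a) E[R(Y_a)]`. Only the diagonal gaps remain. -/
lemma integral_regret [IsProbabilityMeasure P]
    (hind : IndepFun (fun w : A × A × (A → 𝒴) => w.2.1) (fun w => (w.1, w.2.2)) P)
    (hTS : ∀ a, P {w | w.2.1 = a} = P {w | w.1 = a}) (hRm : Measurable R)
    (hR : ∀ a, Integrable (fun w : A × A × (A → 𝒴) => R (w.2.2 a)) P) :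
    ∫ w, (R (w.2.2 w.1) - R (w.2.2 w.2.1)) ∂P =
      ∑ a, ∫ w in {w | w.1 = a}, (R (w.2.2 a) - ∫ z, R (z.2.2 a) ∂P) ∂P := by
  have hX : Measurable fun w : A × A × (A → 𝒴) => w.1 := measurable_fst
  have hA : Measurable fun w : A × A × (A → 𝒴) => w.2.1 := by fun_prop
  have hXY : Measurable fun w : A × A × (A → 𝒴) => (w.1, w.2.2) := by fun_prop
  rw [integral_sub (integrable_fiber (f := fun a w => R (w.2.2 a)) hX hR)
    (integrable_fiber (f := fun a w => R (w.2.2 a)) hA hR),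
    integral_eq_sum_fiber (f := fun a w => R (w.2.2 a)) hX hR,
    integral_eq_sum_fiber (f := fun a w => R (w.2.2 a)) hA hR, ← Finset.sum_sub_distrib]
  refine Finset.sum_congr rfl fun a _ => ?_
  have hm : Measurable fun q : A × (A → 𝒴) => R (q.2 a) := by fun_prop
  have hrestr : (P.restrict {w | w.2.1 = a}).map (fun w => (w.1, w.2.2)) =
      P {w | w.2.1 = a} • P.map (fun w => (w.1, w.2.2)) :=
    map_restrict_of_indepFun hXY hind (measurableSet_singleton a)
  rw [integral_sub (hR a).integrableOn (integrable_const _),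
    ← integral_map (f := fun q : A × (A → 𝒴) => R (q.2 a)) (μ := P.restrict {w | w.2.1 = a})
      hXY.aemeasurable hm.aestronglyMeasurable, hrestr, integral_smul_measure,
    integral_map hXY.aemeasurable hm.aestronglyMeasurable, hTS]
  simp [measureReal_def]

end PosteriorMeasure

/-! ### Bounds on the squared regret under a posterior -/

section RatioBounds

variable {A 𝒴 : Type*} [Fintype A] [MeasurableSpace A] [DiscreteMeasurableSpace A]
  [MeasurableSpace 𝒴] {P : Measure (A × A × (A → 𝒴))} [IsProbabilityMeasure P]

lemma ProbabilityTheory.HasSubgaussianMGF.integrable_of_sub_const {W : Type*} [MeasurableSpace W]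
    {P : Measure W} [IsFiniteMeasure P] {X : W → ℝ} {m : ℝ} {c : NNReal}
    (h : HasSubgaussianMGF (fun w => X w - m) c P) : Integrable X P := by
  exact (h.integrable.add (integrable_const m)).congr (ae_of_all _ fun w => by simp)

/-- Lets gaps be written as conditional means even when the event is null: the integral over it
vanishes, so division by zero does no harm. -/
lemma setIntegral_eq_measureReal_mul_div {W : Type*} [MeasurableSpace W] {P : Measure W}
    [IsFiniteMeasure P] (s : Set W) (f : W → ℝ) :
    ∫ w in s, f w ∂P = P.real s * ((∫ w in s, f w ∂P) / P.real s) := by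
  by_cases h : P.real s = 0
  · rw [setIntegral_measure_zero f ((measureReal_eq_zero_iff).mp h)]; simp
  · field_simp

/-- The weighted squared posterior mean gaps are bounded by the information gain. -/
lemma sum_sq_gap_le_mutualInfo
    (hind : IndepFun (fun w : A × A × (A → 𝒴) => w.2.1) (fun w => (w.1, w.2.2)) P)
    (hTS : ∀ a, P {w | w.2.1 = a} = P {w | w.1 = a}) {f : A → A → 𝒴 → ℝ}
    (hf : ∀ b a, Measurable (f b a)) {c : NNReal}
    (hsub : ∀ b a, HasSubgaussianMGF
      (fun w : A × A × (A → 𝒴) => f b a (w.2.2 a) - ∫ z, f b a (z.2.2 a) ∂P) c P) :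
    ∑ b, ∑ a, P.real {w | w.1 = a} * P.real {w | w.1 = b} *
      ((∫ w in {w | w.1 = b}, (f b a (w.2.2 a) - ∫ z, f b a (z.2.2 a) ∂P) ∂P) /
        P.real {w | w.1 = b}) ^ 2 ≤
      2 * c * (mutualInfo P (fun w => w.1) (fun w => (w.2.1, w.2.2 w.2.1))).toReal := by
  refine le_two_mul_of_forall_quadratic_le c.2 (Finset.sum_nonneg fun b _ =>
    Finset.sum_nonneg fun a _ => by positivity) ENNReal.toReal_nonneg fun k => ?_
  set m : A → A → ℝ := fun b a => ∫ z, f b a (z.2.2 a) ∂P with hm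
  set g : A → A → ℝ := fun b a =>
    (∫ w in {w | w.1 = b}, (f b a (w.2.2 a) - m b a) ∂P) / P.real {w | w.1 = b} with hg
  have hG : ∀ b a, ∫ w in {w | w.1 = b}, (f b a (w.2.2 a) - m b a) ∂P =
      P.real {w | w.1 = b} * g b a := fun b a => setIntegral_eq_measureReal_mul_div _ _
  change _ * ∑ b, ∑ a, _ * _ * g b a ^ 2 ≤ _
  have hint : ∀ b a, Integrable
      (fun w : A × A × (A → 𝒴) => k * g b a * (f b a (w.2.2 a) - m b a)) P := fun b a =>
    (hsub b a).integrable.const_mul _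
  -- With slope `k * g b a`, the pair `(b, a)` contributes `p_a p_b (k - k² c / 2) (g b a)²`.
  have key := sum_integral_le_mutualInfo (P := P) hind
    (F := fun b a y => k * g b a * (f b a y - m b a) - (k * g b a) ^ 2 * c / 2)
    (fun b a => by have := hf b a; fun_prop)
    (fun b a => (hint b a).sub (integrable_const _))
    (fun b a => (hsub b a).lintegral_exp_le_one (k * g b a))
  refine le_of_eq_of_le ?_ key
  rw [Finset.mul_sum]
  refine Finset.sum_congr rfl fun b _ => ?_
  rw [Finset.mul_sum]
  refine Finset.sum_congr rfl fun a _ => ?_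
  rw [integral_sub (hint b a).integrableOn (integrable_const _), integral_const_mul,
    hG, measureReal_def P {w | w.2.1 = a}, hTS]
  simp only [integral_const, smul_eq_mul, measureReal_restrict_apply_univ, ← measureReal_def]
  ring

variable {R : 𝒴 → ℝ} {c : NNReal}

/-- Cauchy–Schwarz over the actions, keeping only the diagonal terms of the double sum of squared
gaps. -/
lemma sq_integral_regret_le_card
    (hind : IndepFun (fun w : A × A × (A → 𝒴) => w.2.1) (fun w => (w.1, w.2.2)) P)
    (hTS : ∀ a, P {w | w.2.1 = a} = P {w | w.1 = a}) (hRm : Measurable R)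
    (hsub : ∀ a, HasSubgaussianMGF
      (fun w : A × A × (A → 𝒴) => R (w.2.2 a) - ∫ z, R (z.2.2 a) ∂P) c P) :
    (∫ w, (R (w.2.2 w.1) - R (w.2.2 w.2.1)) ∂P) ^ 2 ≤ 2 * Fintype.card A * c *
      (mutualInfo P (fun w => w.1) (fun w => (w.2.1, w.2.2 w.2.1))).toReal := by
  have key := sum_sq_gap_le_mutualInfo (f := fun _ _ => R) hind hTS (fun _ _ => hRm)
    (fun _ a => hsub a)
  rw [integral_regret hind hTS hRm fun a => (hsub a).integrable_of_sub_const]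
  rw [Finset.sum_congr rfl fun a _ => setIntegral_eq_measureReal_mul_div _ _]
  calc _ ≤ (Fintype.card A : ℝ) * ∑ a, (P.real {w | w.1 = a} *
        ((∫ w in {w | w.1 = a}, (R (w.2.2 a) - ∫ z, R (z.2.2 a) ∂P) ∂P) /
          P.real {w | w.1 = a})) ^ 2 := sq_sum_le_card_mul_sum_sq
    _ ≤ (Fintype.card A : ℝ) * (2 * c *
      (mutualInfo P (fun w => w.1) (fun w => (w.2.1, w.2.2 w.2.1))).toReal) := by
        refine mul_le_mul_of_nonneg_left ?_ (by positivity)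
        refine le_trans (Finset.sum_le_sum fun b _ => ?_) key
        refine le_trans (le_of_eq ?_) (Finset.single_le_sum
          (f := fun a => P.real {w | w.1 = a} * P.real {w | w.1 = b} *
            ((∫ w in {w | w.1 = b}, (R (w.2.2 a) - ∫ z, R (z.2.2 a) ∂P) ∂P) /
            P.real {w | w.1 = b}) ^ 2) (fun a _ => by positivity) (Finset.mem_univ b))
        ring
    _ = _ := by ring

/-- The map `h b a` recovers the outcome of `b` from that of `a`. Testing with `R ∘ h b a` makes the
gap independent of `a`, so the weights `p_a` sum out and Jensen's inequality for `p` replaces the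
factor `|A|`. -/
lemma sq_integral_regret_le_of_full_information
    (hind : IndepFun (fun w : A × A × (A → 𝒴) => w.2.1) (fun w => (w.1, w.2.2)) P)
    (hTS : ∀ a, P {w | w.2.1 = a} = P {w | w.1 = a}) (hRm : Measurable R)
    (hsub : ∀ a, HasSubgaussianMGF
      (fun w : A × A × (A → 𝒴) => R (w.2.2 a) - ∫ z, R (z.2.2 a) ∂P) c P)
    {h : A → A → 𝒴 → 𝒴} (hh : ∀ b a, Measurable (h b a))
    (heq : ∀ b a, ∀ᵐ w ∂P, h b a (w.2.2 a) = w.2.2 b) :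
    (∫ w, (R (w.2.2 w.1) - R (w.2.2 w.2.1)) ∂P) ^ 2 ≤ 2 * c *
      (mutualInfo P (fun w => w.1) (fun w => (w.2.1, w.2.2 w.2.1))).toReal := by
  have hmean : ∀ b a, ∫ z, R (h b a (z.2.2 a)) ∂P = ∫ z, R (z.2.2 b) ∂P := fun b a =>
    integral_congr_ae ((heq b a).mono fun w hw => by simp only [hw])
  have key := sum_sq_gap_le_mutualInfo (f := fun b a y => R (h b a y)) (c := c) hind hTS
    (fun b a => hRm.comp (hh b a)) (fun b a => by
      refine (hsub b).congr ?_
      filter_upwards [heq b a] with w hw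
      rw [hw, hmean b a])
  rw [integral_regret hind hTS hRm fun a => (hsub a).integrable_of_sub_const]
  rw [Finset.sum_congr rfl fun a _ => setIntegral_eq_measureReal_mul_div _ _]
  have hgap : ∀ b a, ∫ w in {w | w.1 = b}, (R (h b a (w.2.2 a)) - ∫ z, R (h b a (z.2.2 a)) ∂P) ∂P =
      ∫ w in {w | w.1 = b}, (R (w.2.2 b) - ∫ z, R (z.2.2 b) ∂P) ∂P := fun b a => by
    rw [hmean]
    exact integral_congr_ae (ae_restrict_of_ae ((heq b a).mono fun w hw => by simp only [hw]))
  simp_rw [hgap, mul_assoc, ← Finset.sum_mul, sum_measureReal_fiber (P := P) measurable_fst,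
    one_mul] at key
  set p : A → ℝ := fun a => P.real {w | w.1 = a}
  set g : A → ℝ := fun a => (∫ w in {w | w.1 = a}, (R (w.2.2 a) - ∫ z, R (z.2.2 a) ∂P) ∂P) / p a
  rw [mul_assoc]
  refine le_trans ?_ key
  have hp : ∑ a, p a = 1 := sum_measureReal_fiber (P := P) measurable_fst
  have hp0 : ∀ a, 0 ≤ p a := fun a => measureReal_nonneg
  calc (∑ a, p a * g a) ^ 2 ≤ (∑ a, p a) * ∑ a, p a * g a ^ 2 :=
        Finset.sum_sq_le_sum_mul_sum_of_sq_le_mul _ (fun a _ => hp0 a)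
          (fun a _ => mul_nonneg (hp0 a) (sq_nonneg _)) fun a _ => le_of_eq (by ring)
    _ = _ := by rw [hp, one_mul]

/-- The regret is the trace of the matrix `√(p_a p_b) g b a`. Its rows are combinations of the `d`
feature columns weighted by `√(p_a)`, so its rank is at most `d`. -/
lemma sq_integral_regret_le_of_span
    (hind : IndepFun (fun w : A × A × (A → 𝒴) => w.2.1) (fun w => (w.1, w.2.2)) P)
    (hTS : ∀ a, P {w | w.2.1 = a} = P {w | w.1 = a}) (hRm : Measurable R)
    (hsub : ∀ a, HasSubgaussianMGF
      (fun w : A × A × (A → 𝒴) => R (w.2.2 a) - ∫ z, R (z.2.2 a) ∂P) c P) {d : ℕ}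
    {φ : A → Fin d → ℝ} (hlin : ∀ b, ∃ θ : Fin d → ℝ, ∀ a,
      ∫ w in {w | w.1 = b}, (R (w.2.2 a) - ∫ z, R (z.2.2 a) ∂P) ∂P = ∑ i, φ a i * θ i) :
    (∫ w, (R (w.2.2 w.1) - R (w.2.2 w.2.1)) ∂P) ^ 2 ≤ 2 * d * c *
      (mutualInfo P (fun w => w.1) (fun w => (w.2.1, w.2.2 w.2.1))).toReal := by
  have key := sum_sq_gap_le_mutualInfo (f := fun _ _ => R) hind hTS (fun _ _ => hRm)
    (fun _ a => hsub a)
  rw [integral_regret hind hTS hRm fun a => (hsub a).integrable_of_sub_const]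
  rw [Finset.sum_congr rfl fun a _ => setIntegral_eq_measureReal_mul_div _ _]
  choose θ hθ using hlin
  simp_rw [hθ] at key ⊢
  set p : A → ℝ := fun a => P.real {w | w.1 = a}
  have hp0 : ∀ a, 0 ≤ p a := fun a => measureReal_nonneg
  let u : Fin d → EuclideanSpace ℝ A := fun i => WithLp.toLp 2 fun a => √(p a) * φ a i
  let v : A → EuclideanSpace ℝ A := fun b => ∑ i, (√(p b) * θ b i / p b) • u i
  have hv : ∀ b a, v b a = √(p a) * √(p b) * ((∑ i, φ a i * θ b i) / p b) := by
    intro b a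
    simp only [v, u, WithLp.ofLp_sum, WithLp.ofLp_smul, Finset.sum_apply, Pi.smul_apply,
      smul_eq_mul, Finset.sum_div, Finset.mul_sum]
    exact Finset.sum_congr rfl fun i _ => by ring
  have htr := sq_trace_le_of_span_finrank_le (d := d) (Submodule.span ℝ (Set.range u))
    ((finrank_range_le_card u).trans_eq (Fintype.card_fin d)) v fun b =>
      Submodule.sum_mem _ fun i _ => Submodule.smul_mem _ _ (Submodule.subset_span ⟨i, rfl⟩)
  simp_rw [hv, mul_pow, Real.sq_sqrt (hp0 _), Real.mul_self_sqrt (hp0 _)] at htr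
  calc _ ≤ _ := htr
    _ ≤ d * _ := mul_le_mul_of_nonneg_left key (by positivity)
    _ = _ := by ring

/-- Let `q i` be the probability that item `i` lies in the optimal action and `G i` the integral of
its centered value over that event. The regret is `m⁻¹ ∑ G i`, and testing item by item gives `∑ (G
i)² ≤ 2 c I`. `T a i` reads item `i` off the outcome of `a`. -/
lemma sq_integral_regret_le_of_semi_bandit
    (hind : IndepFun (fun w : A × A × (A → 𝒴) => w.2.1) (fun w => (w.1, w.2.2)) P)
    (hTS : ∀ a, P {w | w.2.1 = a} = P {w | w.1 = a}) (hRm : Measurable R) {d m : ℕ}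
    {S : A → Finset (Fin d)} {T : A → Fin d → 𝒴 → ℝ} (hT : ∀ a i, Measurable (T a i))
    {θ : Fin d → A × A × (A → 𝒴) → ℝ} (hθ : ∀ i, Measurable (θ i)) (hθind : iIndepFun θ P)
    (hTθ : ∀ a, ∀ i ∈ S a, ∀ᵐ w ∂P, T a i (w.2.2 a) = θ i w)
    (hRθ : ∀ a, ∀ᵐ w ∂P, R (w.2.2 a) = 1 / (m : ℝ) * ∑ i ∈ S a, θ i w)
    (hsub : ∀ i, HasSubgaussianMGF (fun w => θ i w - ∫ z, θ i z ∂P) c P) :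
    Integrable (fun w : A × A × (A → 𝒴) => R (w.2.2 w.1) - R (w.2.2 w.2.1)) P ∧
    (∫ w, (R (w.2.2 w.1) - R (w.2.2 w.2.1)) ∂P) ^ 2 ≤ 2 * d * c / (m : ℝ) ^ 2 *
      (mutualInfo P (fun w => w.1) (fun w => (w.2.1, w.2.2 w.2.1))).toReal := by
  classical
  have hθint : ∀ i, Integrable (θ i) P := fun i => (hsub i).integrable_of_sub_const
  have hRint : ∀ a, Integrable (fun w : A × A × (A → 𝒴) => R (w.2.2 a)) P := fun a =>
    ((integrable_finsetSum (S a) fun i _ => hθint i).const_mul _).congr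
      ((hRθ a).mono fun w hw => hw.symm)
  refine ⟨integrable_regret hRint, ?_⟩
  set I := (mutualInfo P (fun w => w.1) (fun w => (w.2.1, w.2.2 w.2.1))).toReal
  set μ : Fin d → ℝ := fun i => ∫ z, θ i z ∂P
  set p : A → ℝ := fun a => P.real {w | w.1 = a} with hp
  set H : A → Fin d → ℝ := fun b i => ∫ w in {w | w.1 = b}, (θ i w - μ i) ∂P with hH
  set q : Fin d → ℝ := fun i => ∑ a, if i ∈ S a then p a else 0 with hq
  set G : Fin d → ℝ := fun i => ∑ a, if i ∈ S a then H a i else 0 with hG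
  have hp0 : ∀ a, 0 ≤ p a := fun a => measureReal_nonneg
  -- If `q i = 0`, every action containing `i` is optimal with probability zero, so `G i = 0` as
  -- well.
  have hGq : ∀ i, G i = q i * (G i / q i) := by
    intro i
    by_cases h : q i = 0
    · have h0 : ∀ a ∈ Finset.univ, (if i ∈ S a then p a else 0) = 0 :=
        (Finset.sum_eq_zero_iff_of_nonneg fun a _ => by split_ifs <;> simp [hp0]).mp h
      rw [h, zero_mul]
      refine Finset.sum_eq_zero fun a ha => ?_
      have := h0 a ha
      split_ifs at this ⊢
      · exact setIntegral_measure_zero _ ((measureReal_eq_zero_iff).mp this)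
      · rfl
    · field_simp
  have hcent : ∀ i, Integrable (fun w => θ i w - μ i) P := fun i =>
    (hθint i).sub (integrable_const _)
  have hregret : ∫ w, (R (w.2.2 w.1) - R (w.2.2 w.2.1)) ∂P = 1 / (m : ℝ) * ∑ i, G i := by
    rw [integral_regret hind hTS hRm hRint, Finset.sum_comm, Finset.mul_sum]
    refine Finset.sum_congr rfl fun a _ => ?_
    have hmean : ∫ z, R (z.2.2 a) ∂P = 1 / (m : ℝ) * ∑ i ∈ S a, μ i := by
      rw [integral_congr_ae (hRθ a), integral_const_mul, integral_finsetSum _ fun i _ => hθint i]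
    have : ∫ w in {w | w.1 = a}, (R (w.2.2 a) - ∫ z, R (z.2.2 a) ∂P) ∂P =
        ∫ w in {w | w.1 = a}, (1 / (m : ℝ) * ∑ i ∈ S a, (θ i w - μ i)) ∂P := by
      refine integral_congr_ae (ae_restrict_of_ae ((hRθ a).mono fun w hw => ?_))
      simp only [hw, hmean, Finset.sum_sub_distrib]
      ring
    rw [this, integral_const_mul, integral_finsetSum _ fun i _ => (hcent i).integrableOn,
      Finset.sum_ite_mem, Finset.univ_inter]
  have hS : ∑ i, (q i * (G i / q i)) ^ 2 ≤ 2 * c * I := by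
    refine le_two_mul_of_forall_quadratic_le c.2 (Finset.sum_nonneg fun i _ => sq_nonneg _)
      ENNReal.toReal_nonneg fun k => ?_
    set l : Fin d → ℝ := fun i => k * (G i / q i) with hl
    have hcongr : ∀ b a, ∀ᵐ w ∂P, ∑ i ∈ S a ∩ S b, (l i * (T a i (w.2.2 a) - μ i) -
        l i ^ 2 * c / 2) = ∑ i ∈ S a ∩ S b, (l i * (θ i w - μ i) - l i ^ 2 * c / 2) := by
      intro b a
      have h : ∀ᵐ w ∂P, ∀ i ∈ S a, T a i (w.2.2 a) = θ i w :=
        (Finset.eventually_all (S a)).mpr (hTθ a)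
      filter_upwards [h] with w hw
      refine Finset.sum_congr rfl fun i hi => ?_
      rw [hw i (Finset.mem_inter.mp hi).1]
    have hterm : ∀ i, Integrable (fun w => l i * (θ i w - μ i) - l i ^ 2 * c / 2) P := fun i =>
      ((hcent i).const_mul _).sub (integrable_const _)
    -- Membership in `S a` makes the item observed; membership in `S b` selects the optimal actions
    -- containing it. Summing over `a` yields the factor `q i`, summing over `b` yields `l i * G i -
    -- q i * l i² c / 2`, and `l i = k G i / q i` turns the product into `(k - k² c / 2) (G i)²`.
    have key := sum_integral_le_mutualInfo (P := P) hind
      (F := fun b a y => ∑ i ∈ S a ∩ S b, (l i * (T a i y - μ i) - l i ^ 2 * c / 2))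
      (fun b a => by fun_prop)
      (fun b a => (integrable_finsetSum _ fun i _ => hterm i).congr
        ((hcongr b a).mono fun w hw => hw.symm))
      (fun b a => by
        rw [lintegral_congr_ae (g := fun w => ENNReal.ofReal (Real.exp
          (∑ i ∈ S a ∩ S b, (l i * (θ i w - μ i) - l i ^ 2 * c / 2))))
          ((hcongr b a).mono fun w hw => by simp only [hw])]
        -- Independence of the items factors the exponential moment into factors that are each at
        -- most one.
        simp_rw [Real.exp_sum,
          ENNReal.ofReal_prod_of_nonneg fun i _ => (Real.exp_pos _).le]
        have hm : ∀ i, Measurable fun x : ℝ =>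
            ENNReal.ofReal (Real.exp (l i * (x - μ i) - l i ^ 2 * c / 2)) := fun i => by fun_prop
        have hp := lintegral_prod_eq_prod_lintegral_of_indepFun (S a ∩ S b)
          (fun i w => ENNReal.ofReal (Real.exp (l i * (θ i w - μ i) - l i ^ 2 * c / 2)))
          (hθind.comp _ hm) (fun i => (hm i).comp (hθ i))
        rw [hp]
        exact Finset.prod_le_one' fun i _ => (hsub i).lintegral_exp_le_one (l i))
    refine le_of_eq_of_le ?_ key
    have hval : ∀ b a, ∫ w in {w | w.1 = b}, (∑ i ∈ S a ∩ S b, (l i * (T a i (w.2.2 a) - μ i) -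
        l i ^ 2 * c / 2)) ∂P = ∑ i, if i ∈ S a then if i ∈ S b then
          l i * H b i - p b * (l i ^ 2 * c / 2) else 0 else 0 := by
      intro b a
      rw [integral_congr_ae (ae_restrict_of_ae (hcongr b a)), integral_finsetSum _ fun i _ =>
        (hterm i).integrableOn]
      simp_rw [← ite_and, ← Finset.mem_inter]
      rw [Finset.sum_ite_mem, Finset.univ_inter]
      refine Finset.sum_congr rfl fun i _ => ?_
      rw [integral_sub ((hcent i).const_mul _).integrableOn
        (integrable_const _), integral_const_mul]
      simp [hH, hp]
    have hpa : ∀ a, P.real {w | w.2.1 = a} = p a := fun a => by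
      rw [measureReal_def, hTS]; rfl
    simp_rw [hval, hpa]
    have hswap : ∀ b, ∑ a, p a * (∑ i, if i ∈ S a then if i ∈ S b then
          l i * H b i - p b * (l i ^ 2 * c / 2) else 0 else 0) =
        ∑ i, q i * (l i * (if i ∈ S b then H b i else 0) -
          (if i ∈ S b then p b else 0) * (l i ^ 2 * c / 2)) := by
      intro b
      simp_rw [Finset.mul_sum]
      rw [Finset.sum_comm]
      refine Finset.sum_congr rfl fun i _ => ?_
      rw [hq, Finset.sum_mul]
      refine Finset.sum_congr rfl fun a _ => ?_
      split_ifs <;> simp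
    simp_rw [hswap]
    rw [Finset.sum_comm, Finset.mul_sum]
    refine Finset.sum_congr rfl fun i _ => ?_
    rw [← Finset.mul_sum, Finset.sum_sub_distrib, ← Finset.mul_sum, ← Finset.sum_mul]
    change _ = q i * (l i * G i - q i * _)
    obtain ⟨x, hx⟩ : ∃ x, x = G i / q i := ⟨_, rfl⟩
    have hGi : G i = q i * x := hx ▸ hGq i
    simp only [hl, ← hx]
    rw [hGi]
    ring
  rw [hregret]
  simp_rw [← hGq] at hS
  calc (1 / (m : ℝ) * ∑ i, G i) ^ 2 = (∑ i, G i) ^ 2 / (m : ℝ) ^ 2 := by ring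
    _ ≤ (d * (2 * c * I)) / (m : ℝ) ^ 2 := by
        refine div_le_div_of_nonneg_right ?_ (by positivity)
        refine (sq_sum_le_card_mul_sum_sq).trans ?_
        rw [Finset.card_univ, Fintype.card_fin]
        exact mul_le_mul_of_nonneg_left hS (by positivity)
    _ = _ := by ring

end RatioBounds

/-! ### Measurability of the history -/

/-- Strong induction, because each action depends on the history before it. The σ-algebra on `Ω` is
left free so that the lemma also shows that the history is a function of earlier seeds and outcomes
alone. -/
lemma measurable_banditHistory {Ω A 𝒴 𝒰 : Type*} [Fintype A] [MeasurableSpace A]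
    [DiscreteMeasurableSpace A] [MeasurableSpace 𝒴] [MeasurableSpace 𝒰] {m : MeasurableSpace Ω}
    {act : ℕ → Ω → A} {Y : ℕ → A → Ω → 𝒴} {U : ℕ → Ω → 𝒰}
    (hact : ∀ s, Measurable[MeasurableSpace.comap (banditHistory act Y s) inferInstance ⊔
      MeasurableSpace.comap (U s) inferInstance] (act s)) {n : ℕ}
    (hU : ∀ s < n, Measurable (U s)) (hY : ∀ s < n, ∀ a, Measurable (Y s a)) :
    Measurable (banditHistory act Y n) := by
  induction n using Nat.strong_induction_on with
  | _ n ih =>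
    refine measurable_pi_lambda _ fun s => ?_
    have hs := s.2
    have hh := ih s s.2 (fun r hr => hU r (hr.trans hs)) (fun r hr => hY r (hr.trans hs))
    have hact : Measurable (act s) :=
      (hact s).mono (sup_le hh.comap_le (hU s hs).comap_le) le_rfl
    exact hact.prodMk (measurable_eval_discrete (y := fun ω a => Y s a ω) hact
      (measurable_pi_lambda _ (hY s hs)))

lemma measurable_banditHistory_outcome {Ω A 𝒴 𝒰 : Type*} [Fintype A] [MeasurableSpace A]
    [DiscreteMeasurableSpace A] [MeasurableSpace 𝒴] [MeasurableSpace 𝒰] {m : MeasurableSpace Ω}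
    {act : ℕ → Ω → A} {Y : ℕ → A → Ω → 𝒴} {U : ℕ → Ω → 𝒰} {p : Ω → Measure (A → 𝒴)} {Astar : Ω → A}
    (hact : ∀ s, Measurable[MeasurableSpace.comap (banditHistory act Y s) inferInstance ⊔
      MeasurableSpace.comap (U s) inferInstance] (act s))
    (hAstar : Measurable[MeasurableSpace.comap p inferInstance] Astar) {t : ℕ}
    (hU : ∀ s < t, Measurable (U s)) (hY : ∀ s, Measurable (fun ω a => Y s a ω))
    (hp : Measurable p) :
    Measurable fun ω => (banditHistory act Y t ω, Astar ω, fun a => Y t a ω) :=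
  (measurable_banditHistory hact hU fun s _ a => (measurable_pi_apply a).comp (hY s)).prodMk
    ((hAstar.mono hp.comap_le le_rfl).prodMk (hY t))

/-! ### The posterior and the independence of the action -/

namespace BanditModel

variable {Ω : Type*} [MeasurableSpace Ω] {μ : Measure Ω}
  {A 𝒴 𝒰 : Type*} [MeasurableSpace A] [MeasurableSpace 𝒴] [MeasurableSpace 𝒰]

section History

lemma measurable_Astar' (M : BanditModel μ A 𝒴 𝒰) : Measurable M.Astar :=
  M.measurable_Astar.mono M.measurable_pstar.comap_le le_rfl

variable [Fintype A] [DiscreteMeasurableSpace A] (M : BanditModel μ A 𝒴 𝒰)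

lemma measurable_hist (t : ℕ) : Measurable (M.hist t) :=
  measurable_banditHistory M.measurable_act (fun s _ => M.measurable_U s)
    fun s _ a => M.measurable_Y s a

lemma measurable_act' (t : ℕ) : Measurable (M.act t) :=
  (M.measurable_act t).mono
    (sup_le (M.measurable_hist t).comap_le (M.measurable_U t).comap_le) le_rfl

/-- The triple `(A*, A_t, Y_t)` whose conditional law is the posterior measure. -/
def triple (t : ℕ) (ω : Ω) : A × A × (A → 𝒴) := (M.Astar ω, M.act t ω, fun a => M.Y t a ω)

lemma measurable_triple (t : ℕ) : Measurable (M.triple t) :=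
  M.measurable_Astar'.prodMk
    ((M.measurable_act' t).prodMk (measurable_pi_lambda _ (M.measurable_Y t)))

/-- The history uses only seeds of earlier periods, so the whole tuple is a function of the
variables from which `U t` is independent by assumption. -/
lemma indepFun_U_hist (t : ℕ) :
    IndepFun (M.U t) (fun ω => (M.hist t ω, M.Astar ω, fun a => M.Y t a ω)) μ := by
  have h := M.indep_U t
  rw [IndepFun_iff_Indep] at h ⊢
  refine indep_of_indep_of_le_right h (Measurable.comap_le ?_)
  have hV : Measurable[MeasurableSpace.comap (fun ω => ((fun s : {s : ℕ // s ≠ t} => M.U s ω),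
    (fun (s : ℕ) (a : A) => M.Y s a ω), M.pstar ω)) inferInstance] (fun ω =>
    ((fun s : {s : ℕ // s ≠ t} => M.U s ω), (fun (s : ℕ) (a : A) => M.Y s a ω), M.pstar ω)) :=
    comap_measurable _
  refine measurable_banditHistory_outcome M.measurable_act M.measurable_Astar (fun s hs => ?_)
    (fun s => ?_) ?_
  · exact (measurable_pi_apply (⟨s, hs.ne⟩ : {s : ℕ // s ≠ t})).comp (measurable_fst.comp hV)
  · exact (measurable_pi_apply s).comp (measurable_fst.comp (measurable_snd.comp hV))
  · exact measurable_snd.comp (measurable_snd.comp hV)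

lemma condLaw_comp [IsFiniteMeasure μ] (t : ℕ) {E F : Type*} [MeasurableSpace E]
    [StandardBorelSpace E] [Nonempty E]
    [MeasurableSpace F] [StandardBorelSpace F] [Nonempty F] {X : Ω → E} (hX : Measurable X)
    {f : E → F} (hf : Measurable f) :
    ∀ᵐ ω ∂μ, M.condLaw t (fun ω' => f (X ω')) ω = (M.condLaw t X ω).map f := by
  filter_upwards [ae_of_ae_map (M.measurable_hist t).aemeasurable
    (condDistrib_comp (μ := μ) (M.hist t) hX.aemeasurable hf)] with ω hω
  rw [condLaw, condLaw, ← Kernel.map_apply _ hf, ← hω]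
  rfl

end History

section Posterior

variable [IsProbabilityMeasure μ] [Fintype A] [Nonempty A] [DiscreteMeasurableSpace A]
  [StandardBorelSpace 𝒴] [Nonempty 𝒴] (M : BanditModel μ A 𝒴 𝒰) (t : ℕ)

instance (ω : Ω) : IsProbabilityMeasure (M.posterior t ω) := by
  unfold posterior condLaw; infer_instance

lemma condLaw_triple_comp {F : Type*} [MeasurableSpace F] [StandardBorelSpace F] [Nonempty F]
    {f : A × A × (A → 𝒴) → F} (hf : Measurable f) :
    ∀ᵐ ω ∂μ, M.condLaw t (fun ω' => f (M.triple t ω')) ω = (M.posterior t ω).map f :=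
  M.condLaw_comp t (M.measurable_triple t) hf

/-- The posterior probability of the complement integrates to the probability of an empty event.
This carries pointwise identities between outcomes over to the posterior. -/
lemma ae_posterior_of_forall {p : A × A × (A → 𝒴) → Prop} (hp : MeasurableSet {w | p w})
    (h : ∀ ω, p (M.triple t ω)) : ∀ᵐ ω ∂μ, ∀ᵐ w ∂(M.posterior t ω), p w := by
  have h0 := setLIntegral_preimage_condDistrib (μ := μ) (M.measurable_hist t)
    (M.measurable_triple t).aemeasurable hp.compl MeasurableSet.univ
  have he : M.triple t ⁻¹' {w | p w}ᶜ = ∅ := by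
    ext ω; simp [h ω]
  rw [he, inter_empty, measure_empty, preimage_univ, Measure.restrict_univ,
    lintegral_eq_zero_iff (f := fun ω => condDistrib (M.triple t) (M.hist t) μ (M.hist t ω)
      {w | p w}ᶜ) ((Kernel.measurable_coe _ hp.compl).comp (M.measurable_hist t))] at h0
  filter_upwards [h0] with ω hω
  exact hω

/-- The action is independent of the optimal action and the outcomes under the posterior. -/
lemma indepFun_posterior : ∀ᵐ ω ∂μ, IndepFun (fun w : A × A × (A → 𝒴) => w.2.1)
    (fun w => (w.1, w.2.2)) (M.posterior t ω) := by
  have hH := M.measurable_hist t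
  have hU := M.measurable_U t
  have hA := M.measurable_act' t
  obtain ⟨f, hf, hfact⟩ : ∃ f : (Fin t → A × 𝒴) × 𝒰 → A, Measurable f ∧
      M.act t = f ∘ fun ω => (M.hist t ω, M.U t ω) := by
    have h := M.measurable_act t
    change Measurable[MeasurableSpace.comap (M.hist t) inferInstance ⊔
      MeasurableSpace.comap (M.U t) inferInstance] _ at h
    rw [← MeasurableSpace.comap_prodMk] at h
    exact h.exists_eq_measurable_comp
  set X : Ω → A × (A → 𝒴) := fun ω => (M.Astar ω, fun a => M.Y t a ω) with hXdef
  have hX : Measurable X :=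
    M.measurable_Astar'.prodMk (measurable_pi_lambda _ (M.measurable_Y t))
  have := Measure.isProbabilityMeasure_map (μ := μ) hU.aemeasurable
  have := Measure.isProbabilityMeasure_map (μ := μ) hH.aemeasurable
  have := Measure.isProbabilityMeasure_map (μ := μ) (hH.prodMk hX).aemeasurable
  set κ := condDistrib X (M.hist t) μ with hκ
  -- `η h` is the law of `f (h, U t)`: the conditional law of the action given the history `h`.
  set η : Kernel (Fin t → A × 𝒴) A :=
    (Kernel.id ×ₖ Kernel.const _ (μ.map (M.U t))).map f with hη
  have : IsMarkovKernel η := Kernel.IsMarkovKernel.map _ hf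
  have hηapply : ∀ h {D : Set A}, MeasurableSet D →
      η h D = μ.map (M.U t) (Prod.mk h ⁻¹' (f ⁻¹' D)) := by
    intro h D hD
    rw [hη, Kernel.map_apply' _ hf _ hD, Kernel.prod_apply, Kernel.id_apply, Kernel.const_apply,
      Measure.dirac_prod, Measure.map_apply measurable_prodMk_left (hf hD)]
  have hlaw : μ.map (fun ω => (M.U t ω, M.hist t ω, X ω)) =
      (μ.map (M.U t)).prod (μ.map (M.hist t) ⊗ₘ κ) := by
    rw [compProd_map_condDistrib hX.aemeasurable]
    exact (indepFun_iff_map_prod_eq_prod_map_map hU.aemeasurable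
      (hH.prodMk hX).aemeasurable).mp (M.indepFun_U_hist t)
  -- Given the history, the action and the pair (optimal action, outcomes) have the product law `η ×
  -- κ`. On rectangles this is Fubini with the seed integrated first.
  have hjoint : μ.map (fun ω => (M.hist t ω, M.act t ω, X ω)) = μ.map (M.hist t) ⊗ₘ (η ×ₖ κ) := by
    have := Measure.isProbabilityMeasure_map (μ := μ) (hH.prodMk (hA.prodMk hX)).aemeasurable
    refine Measure.ext_prod₃ fun {C D E} hC hD hE => ?_
    have hset : MeasurableSet {q : 𝒰 × (Fin t → A × 𝒴) × (A × (A → 𝒴)) |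
        q.2.1 ∈ C ∧ f (q.2.1, q.1) ∈ D ∧ q.2.2 ∈ E} := by
      refine (measurable_fst.comp measurable_snd hC).inter
        (MeasurableSet.inter ?_ (measurable_snd.comp measurable_snd hE))
      exact (hf.comp ((measurable_fst.comp measurable_snd).prodMk measurable_fst)) hD
    have hL : μ.map (fun ω => (M.hist t ω, M.act t ω, X ω)) (C ×ˢ D ×ˢ E) =
        μ.map (fun ω => (M.U t ω, M.hist t ω, X ω)) {q | q.2.1 ∈ C ∧ f (q.2.1, q.1) ∈ D ∧
          q.2.2 ∈ E} := by
      rw [Measure.map_apply (hH.prodMk (hA.prodMk hX)) (hC.prod (hD.prod hE)),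
        Measure.map_apply (hU.prodMk (hH.prodMk hX)) hset, hfact]
      rfl
    rw [hL, hlaw, Measure.prod_apply_symm hset, Measure.lintegral_compProd
      (measurable_measure_prodMk_right hset), Measure.compProd_apply (hC.prod (hD.prod hE))]
    refine lintegral_congr fun h => ?_
    by_cases hh : h ∈ C
    · have h1 : Prod.mk h ⁻¹' (C ×ˢ D ×ˢ E) = D ×ˢ E := by ext; simp [hh]
      rw [h1, Kernel.prod_apply, Measure.prod_prod, hηapply h hD]
      have h2 : ∀ x : A × (A → 𝒴), μ.map (M.U t) ((fun u => (u, h, x)) ⁻¹'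
          {q | q.2.1 ∈ C ∧ f (q.2.1, q.1) ∈ D ∧ q.2.2 ∈ E}) =
          E.indicator (fun _ => μ.map (M.U t) (Prod.mk h ⁻¹' (f ⁻¹' D))) x := by
        intro x
        by_cases hx : x ∈ E
        · simp [hx, hh, preimage]
        · simp [hx]
      simp_rw [h2]
      rw [lintegral_indicator_const hE]
    · have h1 : Prod.mk h ⁻¹' (C ×ˢ D ×ˢ E) = ∅ := by ext; simp [hh]
      simp [h1, hh]
  have hcond := condDistrib_ae_eq_of_measure_eq_compProd (μ := μ) (M.hist t)
    (hA.prodMk hX).aemeasurable hjoint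
  have hperm : Measurable fun q : A × A × (A → 𝒴) => (q.2.1, q.1, q.2.2) := by fun_prop
  filter_upwards [ae_of_ae_map hH.aemeasurable hcond,
    M.condLaw_comp t (hA.prodMk hX) hperm] with ω h1 h2
  have h3 : M.posterior t ω = ((η (M.hist t ω)).prod (κ (M.hist t ω))).map
      (fun q : A × A × (A → 𝒴) => (q.2.1, q.1, q.2.2)) := by
    rw [← Kernel.prod_apply, ← h1]
    exact h2
  have hm1 : Measurable fun w : A × A × (A → 𝒴) => w.2.1 := by fun_prop
  have hm2 : Measurable fun w : A × A × (A → 𝒴) => (w.1, w.2.2) := by fun_prop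
  rw [indepFun_iff_map_prod_eq_prod_map_map hm1.aemeasurable hm2.aemeasurable, h3,
    Measure.map_map (hm1.prodMk hm2) hperm, Measure.map_map hm1 hperm, Measure.map_map hm2 hperm]
  have e1 : (fun w : A × A × (A → 𝒴) => (w.2.1, w.1, w.2.2)) ∘
    (fun q : A × A × (A → 𝒴) => (q.2.1, q.1, q.2.2)) = id := rfl
  have e2 : (fun w : A × A × (A → 𝒴) => w.2.1) ∘
    (fun q : A × A × (A → 𝒴) => (q.2.1, q.1, q.2.2)) = Prod.fst := rfl
  have e3 : (fun w : A × A × (A → 𝒴) => (w.1, w.2.2)) ∘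
    (fun q : A × A × (A → 𝒴) => (q.2.1, q.1, q.2.2)) = Prod.snd := rfl
  rw [e1, e2, e3, Measure.map_id]
  change _ = (Measure.fst _).prod (Measure.snd _)
  rw [Measure.fst_prod, Measure.snd_prod]

lemma hasSubgaussianMGF_posterior {f : A × A × (A → 𝒴) → ℝ} (hf : Measurable f) {σ : Ω → ℝ}
    (h : M.CenteredSubGaussian t (fun ω => f (M.triple t ω)) σ) :
    ∀ᵐ ω ∂μ, HasSubgaussianMGF (fun w => f w - ∫ z, f z ∂(M.posterior t ω))
      (σ ω ^ 2).toNNReal (M.posterior t ω) := by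
  -- The exceptional null set may depend on the argument, so only countably many arguments can be
  -- treated at once.
  have h' : ∀ᵐ ω ∂μ, ∀ q : ℚ, _ := ae_all_iff.mpr fun q : ℚ => h q
  filter_upwards [h', M.condLaw_triple_comp t hf] with ω h1 h2
  refine hasSubgaussianMGF_of_rat fun q => ?_
  have h3 := h1 q
  have hm : ∫ z, z ∂(M.condLaw t (fun ω' => f (M.triple t ω')) ω) = ∫ z, f z ∂(M.posterior t ω) := by
    rw [h2, integral_map (f := fun z => z) hf.aemeasurable (by fun_prop)]
  rw [hm, h2, integrable_map_measure (by fun_prop) hf.aemeasurable,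
    integral_map hf.aemeasurable (by fun_prop)] at h3
  refine ⟨h3.1, h3.2.trans_eq ?_⟩
  rw [mul_comm ((q : ℝ) ^ 2), Real.coe_toNNReal _ (sq_nonneg _)]

end Posterior

end BanditModel

lemma indepFun_prodMk_left {Ω E F G : Type*} [MeasurableSpace Ω] [MeasurableSpace E]
    [MeasurableSpace F] [MeasurableSpace G] {μ : Measure Ω} [IsProbabilityMeasure μ]
    {X : Ω → E} {Y : Ω → F} {Z : Ω → G} (hX : Measurable X) (hY : Measurable Y) (hZ : Measurable Z)
    (hYZ : IndepFun Y Z μ) (h : IndepFun X (fun ω => (Y ω, Z ω)) μ) :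
    IndepFun (fun ω => (X ω, Y ω)) Z μ := by
  have hXY : IndepFun X Y μ := h.comp measurable_id measurable_fst
  have h1 := (indepFun_iff_map_prod_eq_prod_map_map hX.aemeasurable
    (hY.prodMk hZ).aemeasurable).mp h
  have h2 := (indepFun_iff_map_prod_eq_prod_map_map hY.aemeasurable hZ.aemeasurable).mp hYZ
  have h3 := (indepFun_iff_map_prod_eq_prod_map_map hX.aemeasurable hY.aemeasurable).mp hXY
  have := Measure.isProbabilityMeasure_map (μ := μ) hX.aemeasurable
  have := Measure.isProbabilityMeasure_map (μ := μ) hY.aemeasurable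
  have := Measure.isProbabilityMeasure_map (μ := μ) hZ.aemeasurable
  have := Measure.isProbabilityMeasure_map (μ := μ) ((hX.prodMk hY).prodMk hZ).aemeasurable
  rw [indepFun_iff_map_prod_eq_prod_map_map (hX.prodMk hY).aemeasurable hZ.aemeasurable, h3]
  refine Measure.ext_prod₃' fun {s t u} hs ht hu => ?_
  have h4 := congrArg (fun ν => ν (s ×ˢ (t ×ˢ u))) h1
  simp only [h2, Measure.prod_prod] at h4
  rw [Measure.map_apply (hX.prodMk (hY.prodMk hZ)) (hs.prod (ht.prod hu))] at h4
  rw [Measure.map_apply ((hX.prodMk hY).prodMk hZ) ((hs.prod ht).prod hu), Measure.prod_prod,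
    Measure.prod_prod, mul_assoc, ← h4]
  congr 1
  ext ω
  simp [and_assoc]

/-! ### The law of the outcomes given the history and the true distribution -/

namespace BanditModel

variable {Ω : Type*} [MeasurableSpace Ω] {μ : Measure Ω}
  {A 𝒴 𝒰 : Type*} [MeasurableSpace A] [MeasurableSpace 𝒴] [MeasurableSpace 𝒰]
  (M : BanditModel μ A 𝒴 𝒰)

/-- The outcome vector of period `t`. -/
def outcome (t : ℕ) (ω : Ω) : A → 𝒴 := fun a => M.Y t a ω

lemma measurable_outcome (t : ℕ) : Measurable (M.outcome t) :=
  measurable_pi_lambda _ (M.measurable_Y t)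

/-- The true outcome distribution together with the outcome vectors before period `t`. -/
def past (t : ℕ) (ω : Ω) : Measure (A → 𝒴) × (Fin t → A → 𝒴) :=
  (M.pstar ω, fun s => M.outcome s ω)

lemma measurable_past (t : ℕ) : Measurable (M.past t) :=
  M.measurable_pstar.prodMk (measurable_pi_lambda _ fun s => M.measurable_outcome s)

lemma isProbabilityMeasure_pstar (ω : Ω) : IsProbabilityMeasure (M.pstar ω) :=
  M.family_prob _ (M.pstar_mem ω)

lemma measurable_pstar_apply {B : Set (A → 𝒴)} (hB : MeasurableSet B) :
    Measurable fun ω => M.pstar ω B :=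
  (Measure.measurable_coe hB).comp M.measurable_pstar

/-- The i.i.d. assumption is the case of indicators; it says that two measures have the same image
under `p*`, hence the same integrals of functions of `p*`. -/
lemma setLIntegral_pstar (s : Finset ℕ) {B : ℕ → Set (A → 𝒴)}
    (hB : ∀ t, MeasurableSet (B t))
    {g : Measure (A → 𝒴) → ℝ≥0∞} (hg : Measurable g) :
    ∫⁻ ω in ⋂ t ∈ s, M.outcome t ⁻¹' B t, g (M.pstar ω) ∂μ =
      ∫⁻ ω, (∏ t ∈ s, M.pstar ω (B t)) * g (M.pstar ω) ∂μ := by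
  have hp := M.measurable_pstar
  have hprod : Measurable fun ω => ∏ t ∈ s, M.pstar ω (B t) :=
    Finset.measurable_fun_prod s fun t _ => M.measurable_pstar_apply (hB t)
  have heq : (μ.restrict (⋂ t ∈ s, M.outcome t ⁻¹' B t)).map M.pstar =
      (μ.withDensity fun ω => ∏ t ∈ s, M.pstar ω (B t)).map M.pstar := by
    ext C hC
    rw [Measure.map_apply hp hC, Measure.map_apply hp hC, Measure.restrict_apply (hp hC),
      withDensity_apply _ (hp hC)]
    exact M.cond_iid s B C hB hC
  calc _ = ∫⁻ p, g p ∂((μ.restrict (⋂ t ∈ s, M.outcome t ⁻¹' B t)).map M.pstar) :=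
        (lintegral_map hg hp).symm
    _ = _ := by
        rw [heq, lintegral_map hg hp, lintegral_withDensity_eq_lintegral_mul _ hprod
          (g := fun ω => g (M.pstar ω)) (hg.comp hp)]
        rfl

/-- On rectangles, the product over `t + 1` periods is the product over `t` periods times `p*(B)`. A
π-system argument extends this to all events of the past. -/
lemma measure_past_inter_outcome [IsProbabilityMeasure μ] (t : ℕ) {B : Set (A → 𝒴)}
    (hB : MeasurableSet B)
    {G : Set (Measure (A → 𝒴) × (Fin t → A → 𝒴))} (hG : MeasurableSet G) :
    μ (M.past t ⁻¹' G ∩ M.outcome t ⁻¹' B) = ∫⁻ ω in M.past t ⁻¹' G, M.pstar ω B ∂μ := by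
  have hV := M.measurable_past t
  have hp := M.measurable_pstar
  have hYs : Measurable fun ω (s : Fin t) => M.outcome s ω :=
    measurable_pi_lambda _ fun s => M.measurable_outcome s
  suffices heq : (μ.restrict (M.outcome t ⁻¹' B)).map (M.past t) =
      (μ.withDensity fun ω => M.pstar ω B).map (M.past t) by
    have h := congrArg (fun ν => ν G) heq
    rwa [Measure.map_apply hV hG, Measure.map_apply hV hG, Measure.restrict_apply (hV hG),
      withDensity_apply _ (hV hG)] at h
  refine Measure.ext_prod fun {C D} hC hD => ?_
  rw [Measure.map_apply hV (hC.prod hD), Measure.map_apply hV (hC.prod hD)]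
  suffices heq : ((μ.restrict (M.outcome t ⁻¹' B)).restrict (M.pstar ⁻¹' C)).map
      (fun ω (s : Fin t) => M.outcome s ω) =
      ((μ.withDensity fun ω => M.pstar ω B).restrict (M.pstar ⁻¹' C)).map
      (fun ω (s : Fin t) => M.outcome s ω) by
    have h := congrArg (fun ν => ν D) heq
    rw [Measure.map_apply hYs hD, Measure.map_apply hYs hD, Measure.restrict_apply (hYs hD),
      Measure.restrict_apply (hYs hD), inter_comm] at h
    exact h
  have key : ∀ Bs : Fin t → Set (A → 𝒴), (∀ s, MeasurableSet (Bs s)) →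
      ((μ.restrict (M.outcome t ⁻¹' B)).restrict (M.pstar ⁻¹' C)).map
      (fun ω (s : Fin t) => M.outcome s ω) (Set.pi univ Bs) =
      ((μ.withDensity fun ω => M.pstar ω B).restrict (M.pstar ⁻¹' C)).map
      (fun ω (s : Fin t) => M.outcome s ω) (Set.pi univ Bs) := by
    intro Bs hBs
    have hpi : MeasurableSet (Set.pi univ Bs) := MeasurableSet.univ_pi hBs
    -- Periods before `t` carry the sides of the rectangle and period `t` carries `B`, so one family
    -- serves both `range t` and `range (t + 1)`.
    let B' : ℕ → Set (A → 𝒴) := fun n => if h : n < t then Bs ⟨n, h⟩ else B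
    have hB' : ∀ n, MeasurableSet (B' n) := fun n => by
      by_cases h : n < t <;> simp [B', h, hB, hBs]
    have hB't : B' t = B := by simp [B']
    have hpre : (fun ω (s : Fin t) => M.outcome s ω) ⁻¹' (Set.pi univ Bs) =
        ⋂ n ∈ Finset.range t, M.outcome n ⁻¹' B' n := by
      ext ω
      simp only [mem_preimage, mem_univ_pi, mem_iInter, Finset.mem_range]
      refine ⟨fun h n hn => ?_, fun h s => ?_⟩
      · simpa [B', hn] using h ⟨n, hn⟩
      · simpa [B'] using h s s.2
    have hE : MeasurableSet (⋂ n ∈ Finset.range t, M.outcome n ⁻¹' B' n) :=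
      Finset.measurableSet_biInter _ fun n _ => M.measurable_outcome n (hB' n)
    have hind : ∀ x : Measure (A → 𝒴) → ℝ≥0∞, ∀ ω,
        C.indicator x (M.pstar ω) = (M.pstar ⁻¹' C).indicator (fun ω => x (M.pstar ω)) ω :=
      fun x ω => rfl
    have h1 := M.setLIntegral_pstar (Finset.range (t + 1)) hB' (g := C.indicator 1)
      (measurable_one.indicator hC)
    have h2 := M.setLIntegral_pstar (Finset.range t) hB' (g := C.indicator fun p => p B)
      ((Measure.measurable_coe hB).indicator hC)
    rw [Measure.map_apply hYs hpi, Measure.map_apply hYs hpi, hpre, Measure.restrict_apply hE,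
      Measure.restrict_apply hE, Measure.restrict_apply (hE.inter (hp hC)),
      withDensity_apply _ (hE.inter (hp hC))]
    have e1 : μ ((⋂ n ∈ Finset.range t, M.outcome n ⁻¹' B' n) ∩ M.pstar ⁻¹' C ∩
        M.outcome t ⁻¹' B) = ∫⁻ ω in ⋂ n ∈ Finset.range (t + 1), M.outcome n ⁻¹' B' n,
          C.indicator 1 (M.pstar ω) ∂μ := by
      simp_rw [hind 1]
      rw [show (fun ω => (M.pstar ⁻¹' C).indicator
        (fun ω => (1 : Measure (A → 𝒴) → ℝ≥0∞) (M.pstar ω)) ω) = (M.pstar ⁻¹' C).indicator 1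
        from rfl, lintegral_indicator_one (hp hC), Measure.restrict_apply (hp hC)]
      congr 1
      ext ω
      simp only [Finset.range_add_one, Finset.set_biInter_insert, hB't, mem_inter_iff]
      tauto
    have e2 : ∫⁻ ω in (⋂ n ∈ Finset.range t, M.outcome n ⁻¹' B' n) ∩ M.pstar ⁻¹' C,
        M.pstar ω B ∂μ = ∫⁻ ω in ⋂ n ∈ Finset.range t, M.outcome n ⁻¹' B' n,
          C.indicator (fun p => p B) (M.pstar ω) ∂μ := by
      simp_rw [hind fun p => p B]
      rw [lintegral_indicator (hp hC), Measure.restrict_restrict (hp hC), inter_comm]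
    rw [e1, e2, h1, h2]
    refine lintegral_congr fun ω => ?_
    rw [Finset.prod_range_succ, hB't, mul_assoc]
    by_cases hω : M.pstar ω ∈ C <;> simp [hω]
  refine ext_of_generate_finite _ generateFrom_pi.symm (isPiSystem_pi) ?_ ?_
  · rintro _ ⟨Bs, hBs, rfl⟩
    exact key Bs fun s => hBs s (mem_univ s)
  · simpa using key (fun _ => univ) fun _ => MeasurableSet.univ

/-- The seeds used before period `t`. -/
def seeds (t : ℕ) (ω : Ω) : Fin t → 𝒰 := fun s => M.U s ω

lemma measurable_seeds (t : ℕ) : Measurable (M.seeds t) :=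
  measurable_pi_lambda _ fun s => M.measurable_U s

/-- The model only makes each seed independent of everything else. Adjoining seeds one at a time
yields independence of the whole block. -/
lemma indepFun_seeds [IsProbabilityMeasure μ] (t : ℕ) :
    IndepFun (M.seeds t) (fun ω => ((fun (s : ℕ) (a : A) => M.Y s a ω), M.pstar ω)) μ := by
  have hW : Measurable fun ω => ((fun (s : ℕ) (a : A) => M.Y s a ω), M.pstar ω) :=
    (measurable_pi_lambda _ fun s => M.measurable_outcome s).prodMk M.measurable_pstar
  induction t with
  | zero =>
    have h : M.seeds 0 = fun _ => Fin.elim0 := by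
      funext ω s; exact s.elim0
    rw [h]
    exact indepFun_const_left _ _
  | succ n ih =>
    have hproj : Measurable fun q : ({s : ℕ // s ≠ n} → 𝒰) × (ℕ → A → 𝒴) × Measure (A → 𝒴) =>
        ((fun s : Fin n => q.1 ⟨s, s.2.ne⟩), q.2) := by
      refine Measurable.prodMk (measurable_pi_lambda _ fun s => ?_) measurable_snd
      exact (measurable_pi_apply (⟨s, s.2.ne⟩ : {s : ℕ // s ≠ n})).comp measurable_fst
    have hU : IndepFun (M.U n) (fun ω => (M.seeds n ω,
        ((fun (s : ℕ) (a : A) => M.Y s a ω), M.pstar ω))) μ :=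
      (M.indep_U n).comp measurable_id hproj
    have h := indepFun_prodMk_left (M.measurable_U n) (M.measurable_seeds n) hW ih hU
    have hsnoc : Measurable fun q : 𝒰 × (Fin n → 𝒰) => (Fin.snoc q.2 q.1 : Fin (n + 1) → 𝒰) := by
      refine measurable_pi_lambda _ fun s => ?_
      refine Fin.lastCases ?_ (fun i => ?_) s
      · simpa using measurable_fst
      · simpa [Function.comp_def] using
          (measurable_pi_apply i).comp (measurable_snd (α := 𝒰) (β := Fin n → 𝒰))
    have h' := h.comp hsnoc measurable_id
    have he : M.seeds (n + 1) = (fun q : 𝒰 × (Fin n → 𝒰) => (Fin.snoc q.2 q.1 : Fin (n + 1) → 𝒰)) ∘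
        fun ω => (M.U n ω, M.seeds n ω) := by
      funext ω s
      refine Fin.lastCases ?_ (fun i => ?_) s <;> simp [seeds]
    rw [he]
    exact h'

/-- The seeds are independent of the true distribution and all outcomes, so by Fubini they can be
frozen and the identity for the past applied to each section. -/
lemma measure_seeds_past_inter_outcome [IsProbabilityMeasure μ] (t : ℕ) {B : Set (A → 𝒴)}
    (hB : MeasurableSet B)
    {G : Set ((Fin t → 𝒰) × Measure (A → 𝒴) × (Fin t → A → 𝒴))} (hG : MeasurableSet G) :
    μ ((fun ω => (M.seeds t ω, M.past t ω)) ⁻¹' G ∩ M.outcome t ⁻¹' B) =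
      ∫⁻ ω in (fun ω => (M.seeds t ω, M.past t ω)) ⁻¹' G, M.pstar ω B ∂μ := by
  have hV := M.measurable_past t
  have hU := M.measurable_seeds t
  have hY := M.measurable_outcome t
  have hUV := hU.prodMk hV
  have := Measure.isProbabilityMeasure_map (μ := μ) hU.aemeasurable
  have := Measure.isProbabilityMeasure_map (μ := μ) hV.aemeasurable
  have hproj : Measurable fun q : (ℕ → A → 𝒴) × Measure (A → 𝒴) =>
      (((q.2, fun s : Fin t => q.1 s) : Measure (A → 𝒴) × (Fin t → A → 𝒴)), q.1 t) := by
    fun_prop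
  have hind : IndepFun (M.seeds t) (fun ω => (M.past t ω, M.outcome t ω)) μ :=
    (M.indepFun_seeds t).comp measurable_id hproj
  have hind' : IndepFun (M.seeds t) (M.past t) μ := hind.comp measurable_id measurable_fst
  have h1 := (indepFun_iff_map_prod_eq_prod_map_map hU.aemeasurable
    (hV.prodMk hY).aemeasurable).mp hind
  have h2 := (indepFun_iff_map_prod_eq_prod_map_map hU.aemeasurable hV.aemeasurable).mp hind'
  have hVY := hV.prodMk hY
  have := Measure.isProbabilityMeasure_map (μ := μ) hVY.aemeasurable
  have hset : MeasurableSet {q : (Fin t → 𝒰) × ((Measure (A → 𝒴) × (Fin t → A → 𝒴)) × (A → 𝒴)) |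
      (q.1, q.2.1) ∈ G ∧ q.2.2 ∈ B} := by
    refine MeasurableSet.inter ?_ (measurable_snd.comp measurable_snd hB)
    exact (measurable_fst.prodMk (measurable_fst.comp measurable_snd)) hG
  have hg : Measurable fun q : (Fin t → 𝒰) × Measure (A → 𝒴) × (Fin t → A → 𝒴) => q.2.1 B :=
    (Measure.measurable_coe hB).comp (measurable_fst.comp measurable_snd)
  have hgi := hg.indicator hG
  calc μ ((fun ω => (M.seeds t ω, M.past t ω)) ⁻¹' G ∩ M.outcome t ⁻¹' B)
      = μ.map (fun ω => (M.seeds t ω, M.past t ω, M.outcome t ω))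
          {q | (q.1, q.2.1) ∈ G ∧ q.2.2 ∈ B} := (Measure.map_apply (hU.prodMk hVY) hset).symm
    _ = ∫⁻ u, μ (M.past t ⁻¹' (Prod.mk u ⁻¹' G) ∩ M.outcome t ⁻¹' B) ∂(μ.map (M.seeds t)) := by
        rw [h1, Measure.prod_apply hset]
        refine lintegral_congr fun u => ?_
        rw [Measure.map_apply hVY (measurable_prodMk_left hset)]
        rfl
    _ = ∫⁻ u, ∫⁻ v, G.indicator (fun q => q.2.1 B) (u, v) ∂(μ.map (M.past t))
          ∂(μ.map (M.seeds t)) := by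
        refine lintegral_congr fun u => ?_
        rw [M.measure_past_inter_outcome t hB (measurable_prodMk_left hG),
          lintegral_map (f := fun v => G.indicator (fun q => q.2.1 B) (u, v))
            (hgi.comp measurable_prodMk_left) hV,
          ← lintegral_indicator (hV (measurable_prodMk_left hG))]
        rfl
    _ = ∫⁻ q, G.indicator (fun q => q.2.1 B) q ∂(μ.map fun ω => (M.seeds t ω, M.past t ω)) := by
        rw [h2, lintegral_prod _ hgi.aemeasurable]
    _ = _ := by
        rw [lintegral_map hgi hUV, ← lintegral_indicator (hUV hG)]
        rfl

/-- The true outcome distribution as a Markov kernel. -/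
def pstarKernel : Kernel Ω (A → 𝒴) := ⟨M.pstar, M.measurable_pstar⟩

instance : IsMarkovKernel M.pstarKernel := ⟨M.isProbabilityMeasure_pstar⟩

variable [Fintype A] [DiscreteMeasurableSpace A]

/-- Given the history and the true outcome distribution, the outcome vector follows the latter. -/
lemma measure_hist_pstar_inter_outcome [IsProbabilityMeasure μ] (t : ℕ) {B : Set (A → 𝒴)}
    (hB : MeasurableSet B) {G : Set ((Fin t → A × 𝒴) × Measure (A → 𝒴))} (hG : MeasurableSet G) :
    μ ((fun ω => (M.hist t ω, M.pstar ω)) ⁻¹' G ∩ M.outcome t ⁻¹' B) =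
      ∫⁻ ω in (fun ω => (M.hist t ω, M.pstar ω)) ⁻¹' G, M.pstar ω B ∂μ := by
  have hcomap : Measurable[MeasurableSpace.comap (fun ω => (M.seeds t ω, M.past t ω)) inferInstance]
      (fun ω => (M.hist t ω, M.pstar ω)) := by
    have hV : Measurable[MeasurableSpace.comap (fun ω => (M.seeds t ω, M.past t ω)) inferInstance]
      (fun ω => (M.seeds t ω, M.past t ω)) := comap_measurable _
    refine Measurable.prodMk (measurable_banditHistory M.measurable_act (fun s hs => ?_)
      (fun s hs a => ?_)) ?_
    · exact (measurable_pi_apply (⟨s, hs⟩ : Fin t)).comp (measurable_fst.comp hV)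
    · exact (measurable_pi_apply a).comp ((measurable_pi_apply (⟨s, hs⟩ : Fin t)).comp
        (measurable_snd.comp (measurable_snd.comp hV)))
    · exact measurable_fst.comp (measurable_snd.comp hV)
  obtain ⟨G', hG', hGG'⟩ := hcomap hG
  rw [← hGG']
  exact M.measure_seeds_past_inter_outcome t hB hG'

end BanditModel

/-- A subspace of `ι → ℝ` is cut out by finitely many linear equations. -/
lemma exists_matrix_forall_mem_iff {ι : Type*} [Fintype ι] (V : Submodule ℝ (ι → ℝ)) :
    ∃ N : ι → ι → ℝ, ∀ v : ι → ℝ, v ∈ V ↔ ∀ j, ∑ i, N j i * v i = 0 := by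
  classical
  obtain ⟨V', hV'⟩ := V.exists_isCompl
  -- The projection onto a complement along `V` has kernel `V`; the rows of its matrix are the
  -- equations.
  let p : (ι → ℝ) →ₗ[ℝ] (ι → ℝ) := V'.subtype ∘ₗ Submodule.projectionOnto V' V hV'.symm
  refine ⟨fun j i => p (fun k => if i = k then 1 else 0) j, fun v => ?_⟩
  have h1 : v ∈ V ↔ p v = 0 := by
    simp [p]
  rw [h1, funext_iff]
  refine forall_congr' fun j => ?_
  rw [LinearMap.pi_apply_eq_sum_univ p v]
  simp [Finset.sum_apply, mul_comm]

/-! ### Posterior mean rewards of a linear bandit -/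

namespace BanditModel

variable {Ω : Type*} [MeasurableSpace Ω] {μ : Measure Ω} [IsProbabilityMeasure μ]
  {A 𝒴 𝒰 : Type*} [Fintype A] [MeasurableSpace A] [DiscreteMeasurableSpace A]
  [MeasurableSpace 𝒴] [MeasurableSpace 𝒰] (M : BanditModel μ A 𝒴 𝒰) (t : ℕ)

/-- On an event determined by the history and `p*`, the law of the outcome vector is the mixture of
the measures `p*`. -/
lemma setIntegral_outcome {ρ : (A → 𝒴) → ℝ} (hρ : Measurable ρ)
    {G : Set ((Fin t → A × 𝒴) × Measure (A → 𝒴))} (hG : MeasurableSet G)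
    (hi : IntegrableOn (fun ω => ρ (M.outcome t ω)) ((fun ω => (M.hist t ω, M.pstar ω)) ⁻¹' G) μ) :
    IntegrableOn (fun ω => ∫ y, ρ y ∂(M.pstar ω)) ((fun ω => (M.hist t ω, M.pstar ω)) ⁻¹' G) μ ∧
    ∫ ω in (fun ω => (M.hist t ω, M.pstar ω)) ⁻¹' G, ρ (M.outcome t ω) ∂μ =
      ∫ ω in (fun ω => (M.hist t ω, M.pstar ω)) ⁻¹' G, ∫ y, ρ y ∂(M.pstar ω) ∂μ := by
  have hY := M.measurable_outcome t
  set s := (fun ω => (M.hist t ω, M.pstar ω)) ⁻¹' G with hs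
  have hlaw : (μ.restrict s).map (M.outcome t) = ((μ.restrict s) ⊗ₘ M.pstarKernel).snd := by
    ext B hB
    rw [Measure.map_apply hY hB, Measure.restrict_apply (hY hB), inter_comm,
      M.measure_hist_pstar_inter_outcome t hB hG, Measure.snd_apply hB,
      Measure.compProd_apply (measurable_snd hB)]
    rfl
  have hi' : Integrable (fun q : Ω × (A → 𝒴) => ρ q.2) ((μ.restrict s) ⊗ₘ M.pstarKernel) := by
    have h : Integrable ρ ((μ.restrict s).map (M.outcome t)) :=
      (integrable_map_measure hρ.aestronglyMeasurable hY.aemeasurable).mpr hi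
    rw [hlaw, Measure.snd] at h
    exact (integrable_map_measure hρ.aestronglyMeasurable measurable_snd.aemeasurable).mp h
  refine ⟨hi'.integral_compProd, ?_⟩
  rw [← integral_map (f := ρ) hY.aemeasurable hρ.aestronglyMeasurable, hlaw, Measure.snd,
    integral_map measurable_snd.aemeasurable hρ.aestronglyMeasurable,
    Measure.integral_compProd hi']
  rfl

variable [Nonempty A] [StandardBorelSpace 𝒴] [Nonempty 𝒴]

/-- The event `A* = b` is determined by `p*`, so conditioning on the history and `p*` replaces each
reward by its mean under `p*`, where the linear relation holds. -/
lemma ae_sum_setIntegral_posterior_eq_zero {c : A → ℝ}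
    (hc : ∀ p ∈ M.family, ∑ a, c a * ∫ y, M.R (y a) ∂p = 0) (b : A) :
    ∀ᵐ ω ∂μ, (∀ a, Integrable (fun w => M.R (w.2.2 a)) (M.posterior t ω)) →
      ∑ a, c a * ∫ w in {w | w.1 = b}, M.R (w.2.2 a) ∂(M.posterior t ω) = 0 := by
  have hH := M.measurable_hist t
  have hT := M.measurable_triple t
  have hR := M.measurable_R
  set κ := condDistrib (M.triple t) (M.hist t) μ with hκ
  obtain ⟨α, hα, hAα⟩ := M.measurable_Astar.exists_eq_measurable_comp
  have hRa : ∀ a, Measurable fun w : A × A × (A → 𝒴) => M.R (w.2.2 a) := fun a => by fun_prop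
  have hw1 : MeasurableSet {w : A × A × (A → 𝒴) | w.1 = b} :=
    measurable_fst (measurableSet_singleton b)
  -- Rewards are integrable under the posterior but perhaps not under `μ`. Restricting to histories
  -- with `N ≤ n` makes conditional expectations available; then `n` runs over the naturals.
  let N : (Fin t → A × 𝒴) → ℝ≥0∞ := fun h => ∑ a, ∫⁻ w, ‖M.R (w.2.2 a)‖ₑ ∂(κ h)
  have hN : Measurable N := Finset.measurable_fun_sum _ fun a _ =>
    (hRa a).enorm.lintegral_kernel
  have key : ∀ n : ℕ, ∀ᵐ ω ∂μ, N (M.hist t ω) ≤ n →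
      ∑ a, c a * ∫ w in {w | w.1 = b}, M.R (w.2.2 a) ∂(M.posterior t ω) = 0 := by
    intro n
    set D : Set (Fin t → A × 𝒴) := {h | N h ≤ n} with hDdef
    have hD : MeasurableSet D := hN measurableSet_Iic
    have hint : ∀ a, IntegrableOn (fun ω => M.R (M.Y t a ω)) (M.hist t ⁻¹' D) μ := by
      intro a
      refine ⟨(M.measurable_R.comp (M.measurable_Y t a)).aestronglyMeasurable, ?_⟩
      have h1 : ∫⁻ ω in M.hist t ⁻¹' D, ‖M.R (M.Y t a ω)‖ₑ ∂μ =
          ∫⁻ h in D, ∫⁻ w, ‖M.R (w.2.2 a)‖ₑ ∂(κ h) ∂(μ.map (M.hist t)) := by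
        have hm : Measurable fun q : (Fin t → A × 𝒴) × (A × A × (A → 𝒴)) =>
            ‖M.R (q.2.2.2 a)‖ₑ := by fun_prop
        have h2 := Measure.setLIntegral_compProd (μ := μ.map (M.hist t)) (κ := κ) hm hD
          MeasurableSet.univ
        rw [compProd_map_condDistrib hT.aemeasurable,
          setLIntegral_map (hD.prod MeasurableSet.univ) hm (hH.prodMk hT)] at h2
        simp only [Measure.restrict_univ] at h2
        rw [← h2]
        congr 2
        ext ω
        simp
      rw [HasFiniteIntegral, h1]
      calc _ ≤ ∫⁻ _ in D, (n : ℝ≥0∞) ∂(μ.map (M.hist t)) := by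
            refine setLIntegral_mono measurable_const fun h hh => le_trans ?_ hh
            exact Finset.single_le_sum (f := fun a => ∫⁻ w, ‖M.R (w.2.2 a)‖ₑ ∂(κ h))
              (fun _ _ => zero_le) (Finset.mem_univ a)
        _ < ∞ := by
            rw [setLIntegral_const]
            exact ENNReal.mul_lt_top (ENNReal.natCast_lt_top n) (measure_lt_top _ _)
    let f : (Fin t → A × 𝒴) × (A × A × (A → 𝒴)) → ℝ :=
      (D ×ˢ {w | w.1 = b}).indicator fun q => ∑ a, c a * M.R (q.2.2.2 a)
    have hDb : MeasurableSet (D ×ˢ {w : A × A × (A → 𝒴) | w.1 = b}) := hD.prod hw1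
    have hAb : MeasurableSet (M.Astar ⁻¹' {b}) := M.measurable_Astar' (measurableSet_singleton b)
    have hfm : StronglyMeasurable f := by
      refine Measurable.stronglyMeasurable (Measurable.indicator ?_ hDb)
      fun_prop
    have hfeq : (fun ω => f (M.hist t ω, M.triple t ω)) =
        (M.hist t ⁻¹' D ∩ M.Astar ⁻¹' {b}).indicator
          fun ω => ∑ a, c a * M.R (M.Y t a ω) := rfl
    have hfint : Integrable (fun ω => f (M.hist t ω, M.triple t ω)) μ := by
      rw [hfeq, integrable_indicator_iff ((hH hD).inter hAb)]
      exact IntegrableOn.mono_set (t := M.hist t ⁻¹' D)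
        (integrable_finsetSum _ fun a _ => (hint a).const_mul (c a)) inter_subset_left
    have hcond := condExp_prod_ae_eq_integral_condDistrib hH hT.aemeasurable hfm hfint
    have hzero : (fun _ => (0 : ℝ)) =ᵐ[μ] μ[fun ω => f (M.hist t ω, M.triple t ω) |
        MeasurableSpace.comap (M.hist t) inferInstance] := by
      refine ae_eq_condExp_of_forall_setIntegral_eq hH.comap_le hfint
        (fun _ _ _ => integrableOn_zero) ?_ aestronglyMeasurable_const
      rintro _ ⟨E, hE, rfl⟩ -
      rw [integral_zero, hfeq, setIntegral_indicator ((hH hD).inter hAb)]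
      set G : Set ((Fin t → A × 𝒴) × Measure (A → 𝒴)) := (E ∩ D) ×ˢ (α ⁻¹' {b}) with hGdef
      have hG : MeasurableSet G := (hE.inter hD).prod (hα (measurableSet_singleton b))
      have hGeq : M.hist t ⁻¹' E ∩ (M.hist t ⁻¹' D ∩ M.Astar ⁻¹' {b}) =
          (fun ω => (M.hist t ω, M.pstar ω)) ⁻¹' G := by
        rw [hAα]
        ext ω
        simp only [hGdef, mem_inter_iff, mem_preimage, mem_prod, Function.comp_apply]
        tauto
      rw [hGeq]
      have hintG : ∀ a, IntegrableOn (fun ω => M.R (M.Y t a ω))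
          ((fun ω => (M.hist t ω, M.pstar ω)) ⁻¹' G) μ := fun a =>
        (hint a).mono_set (by
          rw [← hGeq]
          exact inter_subset_right.trans inter_subset_left)
      have hout := fun a => M.setIntegral_outcome t (ρ := fun y => M.R (y a)) (by fun_prop) hG
        (hintG a)
      rw [integral_finsetSum _ fun a _ => (hintG a).const_mul (c a)]
      simp_rw [integral_const_mul]
      have h3 : ∀ a, ∫ ω in (fun ω => (M.hist t ω, M.pstar ω)) ⁻¹' G, M.R (M.Y t a ω) ∂μ = _ :=
        fun a => (hout a).2
      have h4 := integral_finsetSum (μ := μ.restrict ((fun ω => (M.hist t ω, M.pstar ω)) ⁻¹' G))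
        Finset.univ fun a _ => (hout a).1.const_mul (c a)
      simp_rw [hc _ (M.pstar_mem _), integral_const_mul] at h4
      simp_rw [h3, ← h4]
      simp
    filter_upwards [hcond, hzero] with ω h1 h2 h3
    rw [← h2] at h1
    have h4 : (fun w => f (M.hist t ω, w)) =
        {w : A × A × (A → 𝒴) | w.1 = b}.indicator fun w => ∑ a, c a * M.R (w.2.2 a) := by
      funext w
      have : M.hist t ω ∈ D := h3
      by_cases hw : w.1 = b <;> simp [f, hw, this]
    rw [h4, integral_indicator hw1] at h1
    have hRint : ∀ a, Integrable (fun w => M.R (w.2.2 a)) (M.posterior t ω) := by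
      intro a
      refine ⟨(hRa a).aestronglyMeasurable, lt_of_le_of_lt ?_ (ENNReal.natCast_lt_top n)⟩
      exact le_trans (Finset.single_le_sum (f := fun a => ∫⁻ w, ‖M.R (w.2.2 a)‖ₑ
        ∂(κ (M.hist t ω))) (fun _ _ => zero_le) (Finset.mem_univ a)) h3
    simp_rw [← integral_const_mul]
    rw [← integral_finsetSum _ fun a _ => ((hRint a).const_mul (c a)).integrableOn]
    exact h1.symm
  filter_upwards [ae_all_iff.mpr key] with ω hω hint
  have hfin : N (M.hist t ω) ≠ ∞ := by
    refine ENNReal.sum_ne_top.mpr fun a _ => ?_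
    exact (hint a).2.ne
  obtain ⟨n, hn⟩ := ENNReal.exists_nat_gt hfin
  exact hω n hn.le

/-- The parameter `θ_p` need not depend measurably on `p`, so it cannot be averaged. Membership in
the feature span is instead expressed by finitely many fixed linear equations, each of which passes
to the posterior off a null set. -/
lemma ae_exists_gap_eq_sum {d : ℕ} {φ : A → Fin d → ℝ} (hφ : M.IsLinear φ) :
    ∀ᵐ ω ∂μ, (∀ a, Integrable (fun w => M.R (w.2.2 a)) (M.posterior t ω)) →
      ∀ b, ∃ θ : Fin d → ℝ, ∀ a, ∫ w in {w | w.1 = b},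
        (M.R (w.2.2 a) - ∫ z, M.R (z.2.2 a) ∂(M.posterior t ω)) ∂(M.posterior t ω) =
          ∑ i, φ a i * θ i := by
  let V : Submodule ℝ (A → ℝ) := Submodule.span ℝ (Set.range fun (i : Fin d) a => φ a i)
  have hV : ∀ v : A → ℝ, v ∈ V ↔ ∃ θ : Fin d → ℝ, ∀ a, v a = ∑ i, φ a i * θ i := by
    intro v
    rw [Submodule.mem_span_range_iff_exists_fun]
    refine exists_congr fun θ => ?_
    rw [← funext_iff, eq_comm]
    have : (∑ i, θ i • fun a => φ a i) = fun a => ∑ i, φ a i * θ i := by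
      funext a
      simp [Finset.sum_apply, mul_comm]
    rw [this]
  obtain ⟨N, hN⟩ := exists_matrix_forall_mem_iff V
  have hc : ∀ j, ∀ p ∈ M.family, ∑ a, N j a * ∫ y, M.R (y a) ∂p = 0 := fun j p hp =>
    (hN _).mp ((hV _).mpr (hφ p hp)) j
  have hae : ∀ᵐ ω ∂μ, ∀ j b, (∀ a, Integrable (fun w => M.R (w.2.2 a)) (M.posterior t ω)) →
      ∑ a, N j a * ∫ w in {w | w.1 = b}, M.R (w.2.2 a) ∂(M.posterior t ω) = 0 :=
    ae_all_iff.mpr fun j => ae_all_iff.mpr fun b =>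
      M.ae_sum_setIntegral_posterior_eq_zero t (hc j) b
  filter_upwards [hae] with ω hω hint b
  have hmem : ∀ b, (fun a => ∫ w in {w | w.1 = b}, M.R (w.2.2 a) ∂(M.posterior t ω)) ∈ V :=
    fun b => (hN _).mpr fun j => hω j b hint
  refine (hV _).mp ?_
  have hmean : (fun a => ∫ z, M.R (z.2.2 a) ∂(M.posterior t ω)) ∈ V := by
    have h : (fun a => ∫ z, M.R (z.2.2 a) ∂(M.posterior t ω)) =
        ∑ b, fun a => ∫ w in {w | w.1 = b}, M.R (w.2.2 a) ∂(M.posterior t ω) := by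
      funext a
      rw [Finset.sum_apply]
      exact integral_eq_sum_fiber (f := fun _ (w : A × A × (A → 𝒴)) => M.R (w.2.2 a))
        measurable_fst fun _ => hint a
    rw [h]
    exact V.sum_mem fun b _ => hmem b
  have h : (fun a => ∫ w in {w | w.1 = b},
      (M.R (w.2.2 a) - ∫ z, M.R (z.2.2 a) ∂(M.posterior t ω)) ∂(M.posterior t ω)) =
      (fun a => ∫ w in {w | w.1 = b}, M.R (w.2.2 a) ∂(M.posterior t ω)) -
        (M.posterior t ω).real {w | w.1 = b} •
          fun a => ∫ z, M.R (z.2.2 a) ∂(M.posterior t ω) := by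
    funext a
    rw [integral_sub (hint a).integrableOn (integrable_const _)]
    simp
  rw [h]
  exact V.sub_mem (hmem b) (V.smul_mem _ hmean)

end BanditModel

/-! ### From posterior bounds to the information ratio -/

namespace BanditModel

variable {Ω : Type*} [MeasurableSpace Ω] {μ : Measure Ω} [IsProbabilityMeasure μ]
  {A 𝒴 𝒰 : Type*} [Fintype A] [Nonempty A] [MeasurableSpace A] [DiscreteMeasurableSpace A]
  [MeasurableSpace 𝒴] [StandardBorelSpace 𝒴] [Nonempty 𝒴] [MeasurableSpace 𝒰]
  (M : BanditModel μ A 𝒴 𝒰) (t : ℕ)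

lemma infoRatioLE_of_sq_le {c : ℝ} {ω : Ω} (hint : Integrable M.regretVar (M.posterior t ω))
    (h : (∫ w, M.regretVar w ∂(M.posterior t ω)) ^ 2 ≤ c * (M.infoGain t ω).toReal) (hc : 0 ≤ c) :
    M.InfoRatioLE t c ω := by
  have hA : Measurable fun w : A × A × (A → 𝒴) => w.2.1 := by fun_prop
  have hfin : M.infoGain t ω ≠ ∞ := mutualInfo_ne_top (P := M.posterior t ω) measurable_fst
    (hA.prodMk (measurable_eval_discrete hA (by fun_prop)))
  refine ⟨hint, hfin, ENNReal.div_le_of_le_mul ?_⟩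
  rw [← ENNReal.ofReal_toReal hfin, ← ENNReal.ofReal_mul hc]
  exact ENNReal.ofReal_le_ofReal h

lemma ae_forall_hasSubgaussianMGF_reward {σ : Ω → ℝ}
    (h : ∀ a, M.CenteredSubGaussian t (M.reward t a) σ) :
    ∀ᵐ ω ∂μ, ∀ a, HasSubgaussianMGF
      (fun w => M.R (w.2.2 a) - ∫ z, M.R (z.2.2 a) ∂(M.posterior t ω))
      (σ ω ^ 2).toNNReal (M.posterior t ω) := by
  have hR := M.measurable_R
  exact ae_all_iff.mpr fun a => M.hasSubgaussianMGF_posterior t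
    (f := fun w => M.R (w.2.2 a)) (by fun_prop) (h a)

/-- Conditioning on `A* = a*` multiplies the measure by at most `1 / P(A* = a*)`, which gives
integrability and a finite divergence. The mean bound is applied to the laws of the outcome, whose
divergence appears in the claim. -/
lemma gap_le_of_hasSubgaussianMGF {ω : Ω} {s : ℝ} (hs : 0 ≤ s) (a astar : A)
    (hsub : HasSubgaussianMGF (fun w => M.R (w.2.2 a) - ∫ z, M.R (z.2.2 a) ∂(M.posterior t ω))
      (s ^ 2).toNNReal (M.posterior t ω))
    (hE : M.posterior t ω {w | w.1 = astar} ≠ 0) :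
    Integrable (fun w => M.R (w.2.2 a)) (M.posterior t ω) ∧
      Integrable (fun w => M.R (w.2.2 a)) (M.posteriorGiven t astar ω) ∧
      M.outcomeDiv t a astar ω ≠ ∞ ∧
      (∫ w, M.R (w.2.2 a) ∂(M.posteriorGiven t astar ω)) -
          (∫ w, M.R (w.2.2 a) ∂(M.posterior t ω)) ≤
        s * √(2 * (M.outcomeDiv t a astar ω).toReal) := by
  have hR := M.measurable_R
  have hY : Measurable fun w : A × A × (A → 𝒴) => w.2.2 a := by fun_prop
  set P := M.posterior t ω with hP
  set Q := M.posteriorGiven t astar ω with hQ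
  have hQP : Q ≤ (P {w | w.1 = astar})⁻¹ • P := by
    rw [hQ, posteriorGiven, ProbabilityTheory.cond]
    exact Measure.le_iff.mpr fun u _ => by
      simpa using mul_le_mul_right (Measure.restrict_le_self u) _
  have hc : (P {w | w.1 = astar})⁻¹ ≠ ∞ := ENNReal.inv_ne_top.mpr hE
  have : IsProbabilityMeasure Q := cond_isProbabilityMeasure hE
  have hint : Integrable (fun w => M.R (w.2.2 a)) P := hsub.integrable_of_sub_const
  have hintQ : Integrable (fun w => M.R (w.2.2 a)) Q := hint.of_measure_le_smul hc hQP
  have := Measure.isProbabilityMeasure_map (μ := P) hY.aemeasurable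
  have := Measure.isProbabilityMeasure_map (μ := Q) hY.aemeasurable
  have hfin : M.outcomeDiv t a astar ω ≠ ∞ := by
    refine klDiv_ne_top_of_le_smul hc ?_
    rw [← Measure.map_smul]
    exact Measure.map_mono hQP hY
  refine ⟨hint, hintQ, hfin, ?_⟩
  have hmP : ∫ y, M.R y ∂(P.map fun w => w.2.2 a) = ∫ w, M.R (w.2.2 a) ∂P :=
    integral_map hY.aemeasurable hR.aestronglyMeasurable
  have hmQ : ∫ y, M.R y ∂(Q.map fun w => w.2.2 a) = ∫ w, M.R (w.2.2 a) ∂Q :=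
    integral_map hY.aemeasurable hR.aestronglyMeasurable
  have hsub' : HasSubgaussianMGF (fun y => M.R y - ∫ z, M.R z ∂(P.map fun w => w.2.2 a))
      (s ^ 2).toNNReal (P.map fun w => w.2.2 a) := by
    rw [hmP, ← HasSubgaussianMGF.id_map_iff (by fun_prop)]
    rw [Measure.map_map (by fun_prop) hY]
    exact (HasSubgaussianMGF.id_map_iff (by fun_prop)).mpr hsub
  have h := sq_integral_sub_le_klDiv hfin hR
    ((integrable_map_measure hR.aestronglyMeasurable hY.aemeasurable).mpr hintQ) hsub'
  rw [hmP, hmQ] at h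
  refine le_of_abs_le (abs_le_of_sq_le_sq ?_ (by positivity))
  rw [mul_pow, Real.sq_sqrt (by positivity)]
  refine h.trans_eq ?_
  rw [Real.coe_toNNReal _ (sq_nonneg _)]
  change 2 * s ^ 2 * (M.outcomeDiv t a astar ω).toReal = _
  ring

lemma ae_infoRatioLE_of_full_information {σ : ℝ} (hTS : M.IsThompsonSampling)
    (hsub : ∀ a, M.CenteredSubGaussian t (M.reward t a) fun _ => σ) {𝒵 : Type*}
    [MeasurableSpace 𝒵] {Z : Ω → 𝒵} {enc : A → 𝒵 → 𝒴} (hF : M.IsFullInformation t Z enc) :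
    ∀ᵐ ω ∂μ, M.InfoRatioLE t (2 * σ ^ 2) ω := by
  -- `h` is `enc b` after the inverse of `enc a`, extended measurably beyond the range of `enc a`.
  have hh : ∀ b a, ∃ h : 𝒴 → 𝒴, Measurable h ∧ h ∘ enc a = enc b := fun b a =>
    (hF.enc_embedding a).exists_measurable_extend (hF.enc_embedding b).measurable
      fun _ => inferInstance
  choose h hm heq using hh
  have hae : ∀ᵐ ω ∂μ, ∀ b a, ∀ᵐ w ∂(M.posterior t ω), h b a (w.2.2 a) = w.2.2 b := by
    refine ae_all_iff.mpr fun b => ae_all_iff.mpr fun a => M.ae_posterior_of_forall t ?_ fun ω => ?_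
    · have := hm b a
      exact measurableSet_eq_fun (by fun_prop) (by fun_prop)
    · change h b a (M.Y t a ω) = M.Y t b ω
      rw [hF.outcome_eq, hF.outcome_eq]
      exact congrFun (heq b a) (Z ω)
  filter_upwards [hae, M.ae_forall_hasSubgaussianMGF_reward t hsub, M.indepFun_posterior t,
    ae_all_iff.mpr (hTS t)] with ω h1 h2 h3 h4
  exact M.infoRatioLE_of_sq_le t (integrable_regret fun a => (h2 a).integrable_of_sub_const)
    ((sq_integral_regret_le_of_full_information h3 h4 M.measurable_R h2 hm h1).trans_eq
      (by rw [Real.coe_toNNReal _ (sq_nonneg _)]; rfl)) (by positivity)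

lemma ae_infoRatioLE_of_semi_bandit {σ : ℝ} (hTS : M.IsThompsonSampling) {d m : ℕ}
    {S : A → Finset (Fin d)} {θ : Fin d → Ω → ℝ} {enc : (a : A) → (S a → ℝ) → 𝒴}
    (hS : M.IsSemiBandit t m S θ enc)
    (hsub : ∀ i, M.CenteredSubGaussian t (θ i) fun _ => σ) :
    ∀ᵐ ω ∂μ, M.InfoRatioLE t (2 * d * σ ^ 2 / m ^ 2) ω := by
  classical
  -- An injective Borel map between standard Borel spaces is an embedding, so outcomes can be
  -- decoded measurably.
  have hdec : ∀ a, ∃ D : 𝒴 → (S a → ℝ), Measurable D ∧ D ∘ enc a = id := fun a =>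
    ((hS.enc_measurable a).measurableEmbedding (hS.enc_injective a)).exists_measurable_extend
      measurable_id fun _ => inferInstance
  choose D hDm hD using hdec
  let T : A → Fin d → 𝒴 → ℝ := fun a i y => if h : i ∈ S a then D a y ⟨i, h⟩ else 0
  have hT : ∀ a i, Measurable (T a i) := by
    intro a i
    by_cases h : i ∈ S a
    · simp only [T, h, dite_true]
      exact (measurable_pi_apply _).comp (hDm a)
    · simp [T, h]
  have hTY : ∀ a, ∀ i ∈ S a, ∀ ω, T a i (M.Y t a ω) = θ i ω := by
    intro a i hi ω
    simp only [T, hi, dite_true, hS.outcome_eq]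
    exact congrFun (congrFun (hD a) fun i : S a => θ i ω) ⟨i, hi⟩
  -- The posterior sees only outcomes, so item `i` is read from some action containing it. An item
  -- in no action is set to zero; it affects no reward.
  let Θ : Fin d → A × A × (A → 𝒴) → ℝ := fun i w =>
    if h : ∃ a, i ∈ S a then T h.choose i (w.2.2 h.choose) else 0
  have hΘ : ∀ i, Measurable (Θ i) := by
    intro i
    by_cases h : ∃ a, i ∈ S a
    · simp only [Θ, h, dite_true]
      have := hT h.choose i
      fun_prop
    · simp [Θ, h]
  let r : Fin d → ℝ → ℝ := fun i x => if ∃ a, i ∈ S a then x else 0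
  have hr : ∀ i, Measurable (r i) := by
    intro i
    by_cases h : ∃ a, i ∈ S a
    · simp only [r, h, if_true]; exact measurable_id
    · simp only [r, h, if_false]; exact measurable_const
  have hΘt : ∀ i ω, Θ i (M.triple t ω) = r i (θ i ω) := by
    intro i ω
    by_cases h : ∃ a, i ∈ S a
    · simp only [Θ, r, h, dite_true, if_true]
      exact hTY _ i h.choose_spec ω
    · simp [Θ, r, h]
  have hΘS : ∀ a, ∀ i ∈ S a, ∀ ω, Θ i (M.triple t ω) = θ i ω := fun a i hi ω => by
    rw [hΘt]
    exact if_pos ⟨a, hi⟩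
  have hsubΘ : ∀ᵐ ω ∂μ, ∀ i, HasSubgaussianMGF (fun w => Θ i w - ∫ z, Θ i z ∂(M.posterior t ω))
      (σ ^ 2).toNNReal (M.posterior t ω) := by
    refine ae_all_iff.mpr fun i => ?_
    by_cases h : ∃ a, i ∈ S a
    · refine M.hasSubgaussianMGF_posterior t (σ := fun _ => σ) (hΘ i) ?_
      obtain ⟨a, ha⟩ := h
      rw [show (fun ω => Θ i (M.triple t ω)) = θ i from funext (hΘS a i ha)]
      exact hsub i
    · refine ae_of_all _ fun ω => ?_
      have h0 : Θ i = fun _ => 0 := by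
        funext w
        simp [Θ, h]
      rw [h0]
      refine ⟨by simp, fun l => ?_⟩
      simp only [mgf, integral_zero, sub_zero, mul_zero, Real.exp_zero, integral_const,
        probReal_univ, smul_eq_mul, mul_one]
      exact Real.one_le_exp (by positivity)
  -- The law of `Θ` under the posterior is the image of the conditional law of `θ` under the
  -- coordinatewise map `r`, which preserves independence.
  have hindΘ : ∀ᵐ ω ∂μ, iIndepFun Θ (M.posterior t ω) := by
    have hθm : Measurable fun ω i => θ i ω := measurable_pi_lambda _ hS.measurable_θ
    have hrm : Measurable fun (x : Fin d → ℝ) i => r i (x i) :=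
      measurable_pi_lambda _ fun i => (hr i).comp (measurable_pi_apply i)
    have hΘm : Measurable fun w i => Θ i w := measurable_pi_lambda _ hΘ
    filter_upwards [hS.cond_indep, M.condLaw_comp t hθm hrm, M.condLaw_triple_comp t hΘm]
      with ω h1 h2 h3
    have h4 : (fun ω' => (fun i => Θ i (M.triple t ω'))) = fun ω' i => r i (θ i ω') := by
      funext ω' i
      exact hΘt i ω'
    rw [h4, h2] at h3
    have h5 : ∀ i, (M.posterior t ω).map (Θ i) =
        (M.condLaw t (fun ω' i => θ i ω') ω).map fun x => r i (x i) := by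
      intro i
      have h6 := congrArg (Measure.map fun x : Fin d → ℝ => x i) h3
      rw [Measure.map_map (by fun_prop) hrm, Measure.map_map (by fun_prop) hΘm] at h6
      exact h6.symm
    have : IsProbabilityMeasure (M.condLaw t (fun ω' i => θ i ω') ω) := by
      unfold condLaw; infer_instance
    rw [iIndepFun_iff_map_fun_eq_pi_map fun i => (hΘ i).aemeasurable, ← h3]
    simp_rw [h5]
    exact (iIndepFun_iff_map_fun_eq_pi_map fun i =>
      ((hr i).comp (measurable_pi_apply i)).aemeasurable).mp (h1.comp r hr)
  have hTΘ : ∀ᵐ ω ∂μ, ∀ a, ∀ i, i ∈ S a → ∀ᵐ w ∂(M.posterior t ω), T a i (w.2.2 a) = Θ i w := by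
    refine ae_all_iff.mpr fun a => ae_all_iff.mpr fun i => ?_
    by_cases hi : i ∈ S a
    · filter_upwards [M.ae_posterior_of_forall t (p := fun w => T a i (w.2.2 a) = Θ i w)
        (measurableSet_eq_fun ((hT a i).comp (by fun_prop)) (hΘ i))
        fun ω => (hTY a i hi ω).trans (hΘS a i hi ω).symm] with ω hω _
      exact hω
    · exact ae_of_all _ fun _ h => absurd h hi
  have hRΘ : ∀ᵐ ω ∂μ, ∀ a, ∀ᵐ w ∂(M.posterior t ω),
      M.R (w.2.2 a) = 1 / (m : ℝ) * ∑ i ∈ S a, Θ i w := by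
    have hR := M.measurable_R
    refine ae_all_iff.mpr fun a => M.ae_posterior_of_forall t
      (measurableSet_eq_fun (by fun_prop) (by fun_prop)) fun ω => ?_
    change M.R (M.Y t a ω) = _
    rw [hS.outcome_eq, hS.reward_eq, ← Finset.sum_coe_sort (S a)]
    congr 1
    exact Finset.sum_congr rfl fun i _ => (hΘS a i i.2 ω).symm
  filter_upwards [hsubΘ, hindΘ, hTΘ, hRΘ, M.indepFun_posterior t, ae_all_iff.mpr (hTS t)]
    with ω h1 h2 h3 h4 h5 h6
  have h := sq_integral_regret_le_of_semi_bandit (m := m) h5 h6 M.measurable_R hT hΘ h2 h3 h4 h1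
  rw [Real.coe_toNNReal _ (sq_nonneg _)] at h
  exact M.infoRatioLE_of_sq_le t h.1 h.2 (by positivity)

end BanditModel

theorem mainTheorem7 {Ω : Type*} [MeasurableSpace Ω] (μ : Measure Ω) [IsProbabilityMeasure μ]
    {A 𝒴 𝒰 : Type*} [Fintype A] [Nonempty A] [MeasurableSpace A] [DiscreteMeasurableSpace A]
    [MeasurableSpace 𝒴] [StandardBorelSpace 𝒴] [Nonempty 𝒴] [MeasurableSpace 𝒰]
    (M : BanditModel μ A 𝒴 𝒰) (t : ℕ) :
    -- the gap between conditional and unconditional posterior mean rewards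
    (∀ σ : Ω → ℝ, Measurable[M.histSigma t] σ → (∀ᵐ ω ∂μ, 0 ≤ σ ω) →
      (∀ a, M.CenteredSubGaussian t (M.reward t a) σ) →
      ∀ a astar : A, ∀ᵐ ω ∂μ, M.posterior t ω {w | w.1 = astar} ≠ 0 →
        Integrable (fun w => M.R (w.2.2 a)) (M.posterior t ω) ∧
        Integrable (fun w => M.R (w.2.2 a)) (M.posteriorGiven t astar ω) ∧
        M.outcomeDiv t a astar ω ≠ ∞ ∧
        (∫ w, M.R (w.2.2 a) ∂(M.posteriorGiven t astar ω)) -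
            (∫ w, M.R (w.2.2 a) ∂(M.posterior t ω)) ≤
          σ ω * √(2 * (M.outcomeDiv t a astar ω).toReal)) ∧
    -- bounds on the information ratio of Thompson sampling
    (M.IsThompsonSampling → ∀ σ : ℝ,
      ((∀ a, M.CenteredSubGaussian t (M.reward t a) (fun _ => σ)) →
        (∀ᵐ ω ∂μ, M.InfoRatioLE t (2 * (Fintype.card A : ℝ) * σ ^ 2) ω) ∧
        (∀ (𝒵 : Type*) [MeasurableSpace 𝒵] (Z : Ω → 𝒵) (enc : A → 𝒵 → 𝒴),
          M.IsFullInformation t Z enc → ∀ᵐ ω ∂μ, M.InfoRatioLE t (2 * σ ^ 2) ω) ∧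
        (∀ (d : ℕ) (φ : A → Fin d → ℝ),
          M.IsLinear φ → ∀ᵐ ω ∂μ, M.InfoRatioLE t (2 * (d : ℝ) * σ ^ 2) ω)) ∧
      (∀ (d m : ℕ) (S : A → Finset (Fin d)) (θ : Fin d → Ω → ℝ)
          (enc : (a : A) → (S a → ℝ) → 𝒴),
        0 < m → M.IsSemiBandit t m S θ enc →
        (∀ i, M.CenteredSubGaussian t (θ i) (fun _ => σ)) →
        ∀ᵐ ω ∂μ, M.InfoRatioLE t (2 * (d : ℝ) * σ ^ 2 / (m : ℝ) ^ 2) ω)) := by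
  refine ⟨fun σ _ hσ0 hsub a astar => ?_, fun hTS σ => ⟨fun hsub => ⟨?_, ?_, ?_⟩, ?_⟩⟩
  · filter_upwards [hσ0, M.ae_forall_hasSubgaussianMGF_reward t hsub] with ω h1 h2
    exact M.gap_le_of_hasSubgaussianMGF t h1 a astar (h2 a)
  · filter_upwards [M.ae_forall_hasSubgaussianMGF_reward t hsub, M.indepFun_posterior t,
      ae_all_iff.mpr (hTS t)] with ω h1 h2 h3
    refine M.infoRatioLE_of_sq_le t (integrable_regret fun a => (h1 a).integrable_of_sub_const)
      ((sq_integral_regret_le_card h2 h3 M.measurable_R h1).trans_eq ?_) (by positivity)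
    rw [Real.coe_toNNReal _ (sq_nonneg _)]
    rfl
  · exact fun 𝒵 _ Z enc hF => M.ae_infoRatioLE_of_full_information t hTS hsub hF
  · intro d φ hφ
    filter_upwards [M.ae_forall_hasSubgaussianMGF_reward t hsub, M.indepFun_posterior t,
      ae_all_iff.mpr (hTS t), M.ae_exists_gap_eq_sum t hφ] with ω h1 h2 h3 h4
    have hint := fun a => (h1 a).integrable_of_sub_const
    refine M.infoRatioLE_of_sq_le t (integrable_regret hint)
      ((sq_integral_regret_le_of_span h2 h3 M.measurable_R h1 (h4 hint)).trans_eq ?_)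
      (by positivity)
    rw [Real.coe_toNNReal _ (sq_nonneg _)]
    rfl
  · exact fun d m S θ enc _ hS hsub => M.ae_infoRatioLE_of_semi_bandit t hTS hS hsub
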